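/- **Theorem.** A *disjunctive program* $\Pi$ is a finite set of rules $r$ of the form $a_1\vee\dots\vee a_\ell\leftarrow a_{\ell+1},\dots,a_m,\neg a_{m+1},\dots,\neg a_n$ with distinct propositional atoms $a_1,\dots,a_n$ ($0\le\ell\le m\le n$). We write $\mathrm{at}(r)=\{a_1,\dots,a_n\}$ and $\mathrm{at}(\Pi)=\bigcup_{r\in\Pi}\mathrm{at}(r)$. A set $I$ of atoms satisfies $r$ if some atom of $\{a_1,\dots,a_\ell,a_{m+1},\dots,a_n\}$ is in $I$ or some atom of $\{a_{\ell+1},\dots,a_m\}$ is not in $I$. The reduct $\Pi^I$ is obtained from $\Pi$ by deleting the rules in which some $\neg a$ with $a\in I$ occurs and deleting the negated atoms from the remaining rules. $I$ is an *answer set* of $\Pi$ if it is a $\subseteq$-minimal set satisfying all rules of $\Pi^I$, and $\Pi$ is *consistent* if it has an answer set. The *incidence graph* $\mathcal I_\Pi$ has the atoms in $\mathrm{at}(\Pi)$ and the rules of $\Pi$ as vertices, and an edge between $a$ and $r$ whenever $a\in\mathrm{at}(r)$. A *feedback vertex set* of $\mathcal I_\Pi$ is a set $S$ of vertices whose removal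 leaves an acyclic graph; it is *sparse* if, moreover, for every two distinct atoms $a,b\in\mathrm{at}(\Pi)\setminus S$ there is at most one rule $r\in\Pi$ with $a,b\in\mathrm{at}(r)$. The *(sparse) feedback vertex size* of $\mathcal I_\Pi$ is the smallest cardinality of a (sparse) feedback vertex set of $\mathcal I_\Pi$. Algorithms are deterministic, with running time measured up to polynomial equivalence with Turing machines; programs are given as lists of rules, with the atoms named $0,\dots,|\mathrm{at}(\Pi)|-1$. The *Exponential Time Hypothesis* (ETH) states that there is a $\delta>0$ such that no algorithm decides satisfiability of 3-CNF formulas with $n$ variables and $m$ clauses in time $2^{\delta n}\cdot\mathrm{poly}(n+m)$. Assume ETH. Then for every function $f:\mathbb N\to\mathbb R$ with $f(k)=o(k)$ and every polynomial $p$, there is no algorithm that decides for every disjunctive program $\Pi$ whether $\Pi$ is consistent in time $2^{2^{f(k)}}\cdot p(|\mathrm{at}(\Pi)|)$, where $k$ is the feedback vertex size of $\mathcal I_\Pi$. The same holds if $k$ is the sparse feedback vertex size of $\mathcal I_\Pi$. -/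

import Mathlib

open Filter Asymptotics

/-! ## Machine model

Deterministic while programs over binary trees, the textbook language WHILE.  A program has finitely
many variables, each of which refers to a binary tree.  Forming a pair, taking a component of a pair
and testing for `nil` are unit-cost operations (they are pointer operations: a pair is a cell with two
references, so that `t` steps create at most `t` cells).  Time in this model and time on multi-tape
Turing machines are polynomially related. -/

/-- Binary trees: the data on which programs operate. -/
inductive Val : Type
  | nil : Val
  | cons : Val → Val → Val

namespace Val

def hd : Val → Val
  | nil => nil
  | cons x _ => x

def tl : Val → Val
  | nil => nil
  | cons _ y => y

/-- Lists of trees as trees. -/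
def ofList : List Val → Val
  | [] => nil
  | x :: xs => cons x (ofList xs)

/-- Natural numbers as trees, in unary. -/
def ofNat (n : ℕ) : Val := ofList (List.replicate n nil)

def ofBool : Bool → Val
  | false => nil
  | true => cons nil nil

end Val

/-- The values of the variables `X₀, X₁, X₂, …`. -/
abbrev Store : Type := ℕ → Val

inductive Expr : Type
  | var : ℕ → Expr
  | nil : Expr
  | cons : Expr → Expr → Expr
  | hd : Expr → Expr
  | tl : Expr → Expr

namespace Expr

def eval (s : Store) : Expr → Val
  | var x => s x
  | nil => Val.nil
  | cons e₁ e₂ => Val.cons (e₁.eval s) (e₂.eval s)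
  | hd e => (e.eval s).hd
  | tl e => (e.eval s).tl

/-- The number of elementary operations performed in the evaluation of an expression. -/
def cost : Expr → ℕ
  | var _ => 1
  | nil => 1
  | cons e₁ e₂ => e₁.cost + e₂.cost + 1
  | hd e => e.cost + 1
  | tl e => e.cost + 1

end Expr

/-- Commands: assignment `X := e`, sequencing, `if e then c else d` and `while e do c`, where a test
`e` succeeds if the value of `e` is not `nil`. -/
inductive Cmd : Type
  | assign : ℕ → Expr → Cmd
  | seq : Cmd → Cmd → Cmd
  | ite : Expr → Cmd → Cmd → Cmd
  | loop : Expr → Cmd → Cmd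

/-- `Run c s t s'`: started in the store `s`, the command `c` halts after exactly `t` steps, in the
store `s'`. -/
inductive Run : Cmd → Store → ℕ → Store → Prop
  | assign (x : ℕ) (e : Expr) (s : Store) :
      Run (Cmd.assign x e) s (e.cost + 1) (Function.update s x (e.eval s))
  | seq {c d : Cmd} {s s' s'' : Store} {t t' : ℕ} :
      Run c s t s' → Run d s' t' s'' → Run (Cmd.seq c d) s (t + t') s''
  | ite_pos {e : Expr} {c d : Cmd} {s s' : Store} {t : ℕ} :
      e.eval s ≠ Val.nil → Run c s t s' → Run (Cmd.ite e c d) s (e.cost + 1 + t) s'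
  | ite_neg {e : Expr} {c d : Cmd} {s s' : Store} {t : ℕ} :
      e.eval s = Val.nil → Run d s t s' → Run (Cmd.ite e c d) s (e.cost + 1 + t) s'
  | loop_stop {e : Expr} {c : Cmd} {s : Store} :
      e.eval s = Val.nil → Run (Cmd.loop e c) s (e.cost + 1) s
  | loop_step {e : Expr} {c : Cmd} {s s' s'' : Store} {t t' : ℕ} :
      e.eval s ≠ Val.nil → Run c s t s' → Run (Cmd.loop e c) s' t' s'' →
      Run (Cmd.loop e c) s (e.cost + 1 + t + t') s''

/-- The initial store: the input in `X₀`, all other variables `nil`. -/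
def inputStore (v : Val) : Store := fun x => if x = 0 then v else Val.nil

/-- `M` decides the set `yes` of instances in time `T`: on every encoding `v` of an instance `x` the
program `M` halts within `T x` steps, and it accepts (`X₀` is not `nil` at the end) if and only if
`yes x` holds.  The relation `code x v` says that the tree `v` is an encoding of `x`. -/
def DecidesWithin {ι : Type} (M : Cmd) (code : ι → Val → Prop) (yes : ι → Prop) (T : ι → ℝ) : Prop :=
  ∀ (x : ι) (v : Val), code x v →
    ∃ (t : ℕ) (s : Store), Run M (inputStore v) t s ∧ (t : ℝ) ≤ T x ∧ (s 0 ≠ Val.nil ↔ yes x)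

/-! ## 3-SAT and the Exponential Time Hypothesis -/

/-- A literal over `n` variables: a variable and its sign (`true` for a positive literal). -/
abbrev Literal (n : ℕ) : Type := Fin n × Bool

/-- A clause with three literals; literals may be repeated, so that clauses with one or two distinct
literals are included. -/
abbrev Clause3 (n : ℕ) : Type := Literal n × Literal n × Literal n

/-- A 3-CNF formula over the variables `0, …, numVars - 1`. -/
structure CNF3 : Type where
  numVars : ℕ
  clauses : List (Clause3 numVars)

def Literal.IsTrue {n : ℕ} (σ : Fin n → Bool) (l : Literal n) : Prop := σ l.1 = l.2

def CNF3.Satisfiable (F : CNF3) : Prop :=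
  ∃ σ : Fin F.numVars → Bool, ∀ c ∈ F.clauses,
    Literal.IsTrue σ c.1 ∨ Literal.IsTrue σ c.2.1 ∨ Literal.IsTrue σ c.2.2

def Literal.encode {n : ℕ} (l : Literal n) : Val :=
  Val.cons (Val.ofBool l.2) (Val.ofNat l.1.val)

def Clause3.encode {n : ℕ} (c : Clause3 n) : Val :=
  Val.cons (Literal.encode c.1) (Val.cons (Literal.encode c.2.1) (Literal.encode c.2.2))

def CNF3.encode (F : CNF3) : Val :=
  Val.cons (Val.ofNat F.numVars) (Val.ofList (F.clauses.map Clause3.encode))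

/-- The Exponential Time Hypothesis: for some `δ > 0` there is no algorithm that decides
satisfiability of 3-CNF formulas with `n` variables and `m` clauses in time
`2 ^ (δ n) * poly (n + m)`. -/
def ExponentialTimeHypothesis : Prop :=
  ∃ δ : ℝ, 0 < δ ∧ ∀ (M : Cmd) (p : Polynomial ℕ),
    ¬ DecidesWithin M (fun F v => v = CNF3.encode F) CNF3.Satisfiable
      (fun F => (2 : ℝ) ^ (δ * (F.numVars : ℝ)) *
        ((p.eval (F.numVars + F.clauses.length) : ℕ) : ℝ))

/-! ## Disjunctive logic programs -/

/-- A rule `a₁ ∨ ⋯ ∨ a_ℓ ← a_{ℓ+1}, …, a_m, ¬ a_{m+1}, …, ¬ a_n` with distinct atoms. -/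
structure Rule (α : Type) : Type where
  head : Finset α
  pos : Finset α
  neg : Finset α
  disjoint_head_pos : Disjoint head pos
  disjoint_head_neg : Disjoint head neg
  disjoint_pos_neg : Disjoint pos neg

/-- A (disjunctive) program: a finite set of rules. -/
abbrev Program (α : Type) : Type := Finset (Rule α)

namespace Rule

variable {α : Type}

def atoms [DecidableEq α] (r : Rule α) : Finset α := r.head ∪ r.pos ∪ r.neg

/-- The interpretation `I` satisfies the rule `r`. -/
def SatisfiedBy (r : Rule α) (I : Set α) : Prop :=
  (∃ a, (a ∈ r.head ∨ a ∈ r.neg) ∧ a ∈ I) ∨ ∃ a ∈ r.pos, a ∉ I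

/-- The rule without its negative body. -/
def dropNeg (r : Rule α) : Rule α where
  head := r.head
  pos := r.pos
  neg := ∅
  disjoint_head_pos := r.disjoint_head_pos
  disjoint_head_neg := Finset.disjoint_empty_right _
  disjoint_pos_neg := Finset.disjoint_empty_right _

end Rule

/-- `I` is a model of a set of rules. -/
def IsModel {α : Type} (R : Set (Rule α)) (I : Set α) : Prop := ∀ r ∈ R, r.SatisfiedBy I

namespace Program

variable {α : Type}

def atoms [DecidableEq α] (P : Program α) : Finset α := P.biUnion Rule.atoms

/-- The Gelfond-Lifschitz reduct of `P` under `I`. -/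
def reduct (P : Program α) (I : Set α) : Set (Rule α) :=
  {r' | ∃ r ∈ P, (∀ a ∈ r.neg, a ∉ I) ∧ r' = r.dropNeg}

/-- `I` is an answer set of `P`: a subset-minimal model of the reduct of `P` under `I`. -/
def IsAnswerSet (P : Program α) (I : Set α) : Prop := Minimal (IsModel (P.reduct I)) I

def Consistent (P : Program α) : Prop := ∃ I : Set α, P.IsAnswerSet I

variable [DecidableEq α]

/-- The vertices of the incidence graph: the atoms and the rules of the program. -/
abbrev IncVertex (P : Program α) : Type := {a // a ∈ P.atoms} ⊕ {r // r ∈ P}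

/-- The incidence graph: an atom and a rule are adjacent if the atom occurs in the rule. -/
def incidenceGraph (P : Program α) : SimpleGraph P.IncVertex :=
  SimpleGraph.fromRel fun u v =>
    ∃ (a : {a // a ∈ P.atoms}) (r : {r // r ∈ P}), u = Sum.inl a ∧ v = Sum.inr r ∧ a.1 ∈ r.1.atoms

end Program

/-! ## Feedback vertex sets -/

/-- `S` is a feedback vertex set of `G`: removing `S` from `G` leaves an acyclic graph. -/
def IsFVS {V : Type} (G : SimpleGraph V) (S : Finset V) : Prop :=
  (G.induce {v | v ∉ S}).IsAcyclic

namespace Program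

variable {α : Type} [DecidableEq α]

/-- `S` is a sparse feedback vertex set of the incidence graph of `P`: for every two atoms that are
not in `S` the program has at most one rule over both of them. -/
def IsSparseFVS (P : Program α) (S : Finset P.IncVertex) : Prop :=
  IsFVS P.incidenceGraph S ∧
    ∀ a b : {a // a ∈ P.atoms}, a ≠ b → Sum.inl a ∉ S → Sum.inl b ∉ S →
      ∀ r ∈ P, ∀ r' ∈ P, a.1 ∈ r.atoms → b.1 ∈ r.atoms → a.1 ∈ r'.atoms → b.1 ∈ r'.atoms → r = r'

/-- The feedback vertex size of the incidence graph. -/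
noncomputable def fvsSize (P : Program α) : ℕ :=
  sInf {k | ∃ S : Finset P.IncVertex, IsFVS P.incidenceGraph S ∧ S.card = k}

/-- The sparse feedback vertex size of the incidence graph. -/
noncomputable def sparseFvsSize (P : Program α) : ℕ :=
  sInf {k | ∃ S : Finset P.IncVertex, P.IsSparseFVS S ∧ S.card = k}

end Program

/-! ## Programs as inputs -/

/-- The tree `v` is a list that has exactly one entry for each element of `s`, in an arbitrary order,
where `code` says which trees encode which elements. -/
def EncodesFinset {β : Type} (code : β → Val → Prop) (s : Finset β) (v : Val) : Prop :=
  ∃ (l : List β) (vs : List Val),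
    (l : Multiset β) = s.val ∧ List.Forall₂ code l vs ∧ v = Val.ofList vs

def EncodesAtoms {n : ℕ} (s : Finset (Fin n)) (v : Val) : Prop :=
  EncodesFinset (fun a u => u = Val.ofNat a.val) s v

def EncodesRule {n : ℕ} (r : Rule (Fin n)) (v : Val) : Prop :=
  ∃ h p q : Val, EncodesAtoms r.head h ∧ EncodesAtoms r.pos p ∧ EncodesAtoms r.neg q ∧
    v = Val.cons h (Val.cons p q)

/-- An input of the consistency problem: a program whose atoms are named `0, …, numAtoms - 1`. -/
structure ProgramInput : Type where
  numAtoms : ℕ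
  prog : Program (Fin numAtoms)
  atoms_eq : prog.atoms = Finset.univ

def ProgramInput.Encodes (x : ProgramInput) (v : Val) : Prop :=
  EncodesFinset EncodesRule x.prog v

/-! ## Polynomial-time functions on trees -/

namespace Val

/-! The lower bound comes from a polynomial-time reduction from 3-SAT to consistency in which the
sparse feedback vertex size of the program is only logarithmic in the number `n` of variables.

Remove repeated clauses, so that at most `8 n ^ 3` remain, and index them by bit vectors `β` of
length `k = O(log n)`; superfluous vectors get a clause of literals that are always true. The
program guesses an assignment by rules `lit i false ∨ lit i true` and a vector by rules `bit j false
∨ bit j true`. For each `β` and each of the three literals `L` of its clause there is a rule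
deriving `sat` from `L`, the bits of `β` and one auxiliary fact. The constraint `← ¬ sat` forces
`sat` into every answer set, and the saturation rules `bit j b ← sat` then force all the bit atoms
into it. Such a saturated set is minimal exactly if no single vector `β` yields a smaller model
without `sat`, that is, if the guessed assignment makes a literal of every clause true. Minimality
thus supplies the universal quantifier over the clauses (`Program.consistent_iff`).

Every clause rule contains just one literal atom. Hence, after deletion of `sat`, the four facts and
the `2 k` bit atoms, each choice rule with its two literal atoms and the clause rules pendant at
them forms a tree, and two literal atoms share at most a choice rule. So `5 + 2 k` atoms form a
sparse feedback vertex set (`Program.exists_isSparseFVS`).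

Since `k` is about `3 log₂ n`, the number `2 ^ o(k)` is sublinear in `n` (`exists_two_rpow_le`), and
an algorithm with running time `2 ^ 2 ^ o(k)` times a polynomial would decide 3-SAT in time `2 ^ (δ
n)` times a polynomial, for every `δ > 0`. For this the reduction is written as a function
`Val.reduction` on trees, shown to be computable in polynomial time by closure properties
(`PolyTime`, chiefly under folds over lists), and its output is identified with an encoding of the
program (`exists_programInput`). -/

def size : Val → ℕ
  | nil => 1
  | cons a b => a.size + b.size + 1

def toList : Val → List Val
  | nil => []
  | cons x y => x :: y.toList

/-- Case distinction: `b` if `a` is `nil`, and `c` otherwise. -/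
def cond (a b c : Val) : Val :=
  match a with
  | nil => b
  | cons _ _ => c

@[simp] theorem toList_nil : nil.toList = [] := rfl

@[simp] theorem toList_cons (x y : Val) : (cons x y).toList = x :: y.toList := rfl

@[simp] theorem hd_cons (x y : Val) : (cons x y).hd = x := rfl

@[simp] theorem tl_cons (x y : Val) : (cons x y).tl = y := rfl

@[simp] theorem cond_nil (b c : Val) : cond nil b c = b := rfl

@[simp] theorem cond_cons (x y b c : Val) : cond (cons x y) b c = c := rfl

@[simp] theorem toList_ofList (l : List Val) : (ofList l).toList = l := by
  induction l with
  | nil => rfl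
  | cons x l ih => simp [ofList, ih]

theorem ofList_toList (v : Val) : ofList v.toList = v := by
  induction v with
  | nil => rfl
  | cons x y _ ih => simp [ofList, ih]

@[simp] theorem size_nil : nil.size = 1 := rfl

@[simp] theorem size_cons (x y : Val) : (cons x y).size = x.size + y.size + 1 := rfl

theorem size_hd_le (v : Val) : v.hd.size ≤ v.size := by
  cases v with
  | nil => simp [hd]
  | cons x y => simp; omega

theorem size_tl_le (v : Val) : v.tl.size ≤ v.size := by
  cases v with
  | nil => simp [tl]
  | cons x y => simp; omega

theorem size_cond_le (a b c : Val) : (cond a b c).size ≤ max b.size c.size := by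
  cases a <;> simp

theorem length_toList_le (v : Val) : v.toList.length ≤ v.size := by
  induction v with
  | nil => simp
  | cons x y _ ih => simp; omega

theorem size_le_of_mem_toList {v x : Val} (h : x ∈ v.toList) : x.size ≤ v.size := by
  induction v with
  | nil => simp at h
  | cons a y _ ih =>
    rcases List.mem_cons.1 h with rfl | h
    · simp; omega
    · have := ih h; simp; omega

end Val

/-! ### Closure properties of polynomial-time functions -/

theorem Polynomial.eval_nat_mono (p : Polynomial ℕ) : Monotone fun n => p.eval n := by
  intro a b h
  induction p using Polynomial.induction_on' with
  | add p q hp hq => simpa using add_le_add hp hq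
  | monomial n c => simpa using Nat.mul_le_mul_left c (Nat.pow_le_pow_left h n)

/-- The command `c` computes `f` in `X₀` in time `T`, from arbitrary values of the other variables,
and does not change the variables above `B`. -/
def Computes (c : Cmd) (B : ℕ) (f : Val → Val) (T : ℕ → ℕ) : Prop :=
  ∀ s : Store, ∃ (t : ℕ) (s' : Store), Run c s t s' ∧ t ≤ T (s 0).size ∧ s' 0 = f (s 0) ∧
    ∀ x, B < x → s' x = s x

/-- `f` is computed in polynomial time, and the size of its values is polynomially bounded. -/
@[fun_prop]
def PolyTime (f : Val → Val) : Prop :=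
  ∃ (c : Cmd) (B : ℕ) (p : Polynomial ℕ), Computes c B f (fun n => p.eval n) ∧
    ∀ v, (f v).size ≤ p.eval v.size

theorem Computes.mono {c : Cmd} {B B' : ℕ} {f : Val → Val} {T T' : ℕ → ℕ} (h : Computes c B f T)
    (hB : B ≤ B') (hT : ∀ n, T n ≤ T' n) : Computes c B' f T' := by
  intro s
  obtain ⟨t, s', hr, ht, h0, hs⟩ := h s
  exact ⟨t, s', hr, ht.trans (hT _), h0, fun x hx => hs x (hB.trans_lt hx)⟩

theorem PolyTime.of_computes {c : Cmd} {B : ℕ} {f : Val → Val} {p q : Polynomial ℕ}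
    (h : Computes c B f (fun n => p.eval n)) (hq : ∀ v, (f v).size ≤ q.eval v.size) :
    PolyTime f := by
  refine ⟨c, B, p + q, h.mono le_rfl fun n => ?_, fun v => ?_⟩
  · simp
  · simpa using (hq v).trans (Nat.le_add_left _ _)

theorem PolyTime.size_le {f : Val → Val} (hf : PolyTime f) :
    ∃ p : Polynomial ℕ, ∀ v, (f v).size ≤ p.eval v.size :=
  let ⟨_, _, p, _, hp⟩ := hf
  ⟨p, hp⟩

theorem PolyTime.of_expr (e : Expr) (q : Polynomial ℕ) (f : Val → Val)
    (he : ∀ s : Store, e.eval s = f (s 0)) (hq : ∀ v, (f v).size ≤ q.eval v.size) : PolyTime f := by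
  refine PolyTime.of_computes (c := Cmd.assign 0 e) (B := 0) (p := Polynomial.C (e.cost + 1))
    (fun s => ⟨_, _, Run.assign 0 e s, by simp, by simp [he], fun x hx => ?_⟩) hq
  simp [Function.update_of_ne hx.ne']

@[fun_prop]
theorem PolyTime.id : PolyTime fun v => v :=
  PolyTime.of_expr (Expr.var 0) Polynomial.X _ (fun _ => rfl) (by simp)

@[fun_prop]
theorem PolyTime.const (w : Val) : PolyTime fun _ => w := by
  have : ∃ e : Expr, ∀ s : Store, e.eval s = w := by
    induction w with
    | nil => exact ⟨Expr.nil, fun _ => rfl⟩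
    | cons x y hx hy =>
      obtain ⟨e, he⟩ := hx
      obtain ⟨e', he'⟩ := hy
      exact ⟨Expr.cons e e', fun s => by simp [Expr.eval, he, he']⟩
  obtain ⟨e, he⟩ := this
  exact PolyTime.of_expr e (Polynomial.C w.size) _ he (by simp)

@[fun_prop]
theorem PolyTime.comp {f g : Val → Val} (hf : PolyTime f) (hg : PolyTime g) :
    PolyTime fun v => f (g v) := by
  obtain ⟨c, B, p, hc, hp⟩ := hf
  obtain ⟨c', B', p', hc', hp'⟩ := hg
  refine PolyTime.of_computes (c := Cmd.seq c' c) (B := max B B') (p := p' + p.comp p')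
    (q := p.comp p') (fun s => ?_) fun v => ?_
  · obtain ⟨t, s', hr, ht, h0, hs⟩ := hc' s
    obtain ⟨t', s'', hr', ht', h0', hs'⟩ := hc s'
    refine ⟨_, _, Run.seq hr hr', ?_, by rw [h0', h0], fun x hx => ?_⟩
    · have := p.eval_nat_mono (hp' (s 0))
      simp only [h0, Polynomial.eval_add, Polynomial.eval_comp] at *
      omega
    · rw [hs' x (lt_of_le_of_lt (le_max_left _ _) hx), hs x (lt_of_le_of_lt (le_max_right _ _) hx)]
  · rw [Polynomial.eval_comp]
    exact (hp _).trans (p.eval_nat_mono (hp' v))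

@[fun_prop]
theorem PolyTime.hd {f : Val → Val} (hf : PolyTime f) : PolyTime fun v => (f v).hd :=
  PolyTime.comp (PolyTime.of_expr (Expr.hd (Expr.var 0)) Polynomial.X Val.hd (fun _ => rfl)
    (by simpa using Val.size_hd_le)) hf

@[fun_prop]
theorem PolyTime.tl {f : Val → Val} (hf : PolyTime f) : PolyTime fun v => (f v).tl :=
  PolyTime.comp (PolyTime.of_expr (Expr.tl (Expr.var 0)) Polynomial.X Val.tl (fun _ => rfl)
    (by simpa using Val.size_tl_le)) hf

/-- The command that runs `c` on the value of `X₀` and leaves the old value of `X₀` in `X_k`. -/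
theorem Run.save {c : Cmd} {B k : ℕ} {f : Val → Val} {T : ℕ → ℕ} (h : Computes c B f T) (hk : B < k)
    (s : Store) : ∃ (t : ℕ) (s' : Store),
      Run (Cmd.seq (Cmd.assign k (Expr.var 0)) c) s t s' ∧ t ≤ T (s 0).size + 2 ∧
      s' 0 = f (s 0) ∧ s' k = s 0 ∧ ∀ x, B < x → x ≠ k → s' x = s x := by
  obtain ⟨t, s', hr, ht, h0, hs⟩ := h (Function.update s k (s 0))
  have hk0 : (0 : ℕ) ≠ k := by omega
  rw [Function.update_of_ne hk0] at ht h0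
  refine ⟨_, _, Run.seq (Run.assign _ _ _) hr, ?_, h0, ?_, fun x hx hxk => ?_⟩
  · simp only [Expr.cost]; omega
  · rw [hs k hk]; simp
  · rw [hs x hx, Function.update_of_ne hxk]

@[fun_prop]
theorem PolyTime.cons {f g : Val → Val} (hf : PolyTime f) (hg : PolyTime g) :
    PolyTime fun v => Val.cons (f v) (g v) := by
  obtain ⟨c, B, p, hc, hp⟩ := hf
  obtain ⟨c', B', p', hc', hp'⟩ := hg
  -- Variables above both bounds survive both commands: `X_k` keeps the input for `c'`, and
  -- `X_{k+1}` keeps the value of `f`.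
  set k := B + B' + 1 with hk
  refine PolyTime.of_computes (B := k + 1) (p := p + p' + 13) (q := p + p' + 1)
    (c := Cmd.seq (Cmd.seq (Cmd.assign k (Expr.var 0)) c)
      (Cmd.seq (Cmd.assign (k + 1) (Expr.var 0)) (Cmd.seq (Cmd.assign 0 (Expr.var k))
        (Cmd.seq c' (Cmd.assign 0 (Expr.cons (Expr.var (k + 1)) (Expr.var 0)))))))
    (fun s => ?_) fun v => ?_
  · obtain ⟨t, s', hr, ht, h0, hsk, hs⟩ := Run.save hc (show B < k by omega) s
    set s₁ := Function.update s' (k + 1) (s' 0) with hs₁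
    obtain ⟨t', s'', hr', ht', h0', hs'⟩ := hc' (Function.update s₁ 0 (s₁ k))
    have e : s₁ k = s 0 := by rw [hs₁, Function.update_of_ne (by omega), hsk]
    rw [Function.update_self, e] at ht' h0'
    refine ⟨_, _, Run.seq hr (Run.seq (Run.assign _ _ _) (Run.seq (Run.assign _ _ _)
      (Run.seq hr' (Run.assign _ _ _)))), ?_, ?_, fun x hx => ?_⟩
    · simp only [Expr.cost, Polynomial.eval_add, Polynomial.eval_ofNat] at *; omega
    · simp only [Function.update_self, Expr.eval]
      rw [h0', hs' _ (by omega), Function.update_of_ne (by omega), hs₁, Function.update_self, h0]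
    · rw [Function.update_of_ne (by omega), hs' _ (by omega), Function.update_of_ne (by omega), hs₁,
        Function.update_of_ne (by omega), hs _ (by omega) (by omega)]
  · have := hp v
    have := hp' v
    simp only [Val.size_cons, Polynomial.eval_add, Polynomial.eval_one]; omega

@[fun_prop]
theorem PolyTime.cond {f g h : Val → Val} (hf : PolyTime f) (hg : PolyTime g) (hh : PolyTime h) :
    PolyTime fun v => Val.cond (f v) (g v) (h v) := by
  obtain ⟨c, B, p, hc, hp⟩ := hf
  obtain ⟨c₁, B₁, p₁, hc₁, hp₁⟩ := hg
  obtain ⟨c₂, B₂, p₂, hc₂, hp₂⟩ := hh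
  set k := B + B₁ + B₂ + 1 with hk
  refine PolyTime.of_computes (B := k + 1) (p := p + p₁ + p₂ + 13) (q := p₁ + p₂)
    (c := Cmd.seq (Cmd.seq (Cmd.assign k (Expr.var 0)) c)
      (Cmd.seq (Cmd.assign (k + 1) (Expr.var 0)) (Cmd.seq (Cmd.assign 0 (Expr.var k))
        (Cmd.ite (Expr.var (k + 1)) c₂ c₁))))
    (fun s => ?_) fun v => ?_
  · obtain ⟨t, s', hr, ht, h0, hsk, hs⟩ := Run.save hc (show B < k by omega) s
    set s₁ := Function.update s' (k + 1) (s' 0) with hs₁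
    have e : s₁ k = s 0 := by rw [hs₁, Function.update_of_ne (by omega), hsk]
    set s₂ := Function.update s₁ 0 (s₁ k) with hs₂
    have e₂ : s₂ 0 = s 0 := by rw [hs₂, Function.update_self, e]
    have e₃ : s₂ (k + 1) = f (s 0) := by
      rw [hs₂, Function.update_of_ne (by omega), hs₁, Function.update_self, h0]
    have e₄ : ∀ x, k + 1 < x → s₂ x = s x := fun x hx => by
      rw [hs₂, Function.update_of_ne (by omega), hs₁, Function.update_of_ne (by omega),
        hs _ (by omega) (by omega)]
    cases hfv : f (s 0) with
    | nil =>
      obtain ⟨t', s'', hr', ht', h0', hs'⟩ := hc₁ s₂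
      rw [e₂] at ht' h0'
      refine ⟨_, _, Run.seq hr (Run.seq (Run.assign _ _ _) (Run.seq (Run.assign _ _ _)
        (Run.ite_neg (e₃.trans hfv) hr'))), ?_, by simpa using h0', fun x hx => ?_⟩
      · simp only [Expr.cost, Polynomial.eval_add, Polynomial.eval_ofNat] at *; omega
      · rw [hs' _ (by omega), e₄ _ hx]
    | cons a b =>
      obtain ⟨t', s'', hr', ht', h0', hs'⟩ := hc₂ s₂
      rw [e₂] at ht' h0'
      refine ⟨_, _, Run.seq hr (Run.seq (Run.assign _ _ _) (Run.seq (Run.assign _ _ _)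
        (Run.ite_pos (ne_of_eq_of_ne (e₃.trans hfv) (by simp)) hr'))), ?_, by simpa using h0',
        fun x hx => ?_⟩
      · simp only [Expr.cost, Polynomial.eval_add, Polynomial.eval_ofNat] at *; omega
      · rw [hs' _ (by omega), e₄ _ hx]
  · have := hp₁ v
    have := hp₂ v
    have := Val.size_cond_le (f v) (g v) (h v)
    simp only [Polynomial.eval_add]; omega

/-- One loop over the list in `X_{k+1}`, with the accumulator in `X₀` and the environment in `X_k`. -/
theorem Run.foldl_loop {c : Cmd} {B k : ℕ} {g : Val → Val → Val → Val} {p : Polynomial ℕ}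
    (hc : Computes c B (fun w => g w.tl.tl w.tl.hd w.hd) (fun n => p.eval n)) (hk : B < k)
    (v : Val) (Q : ℕ) (l : Val) (s : Store) (hsk : s k = v) (hsl : s (k + 1) = l)
    (hQ : ∀ l', l' <+: l.toList → (l'.foldl (g v) (s 0)).size ≤ Q) :
    ∃ (t : ℕ) (s' : Store), Run (Cmd.loop (Expr.var (k + 1)) (Cmd.seq
        (Cmd.assign 0 (Expr.cons (Expr.hd (Expr.var (k + 1))) (Expr.cons (Expr.var 0) (Expr.var k))))
        (Cmd.seq c (Cmd.assign (k + 1) (Expr.tl (Expr.var (k + 1))))))) s t s' ∧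
      t ≤ l.toList.length * (p.eval (l.size + Q + v.size + 2) + 12) + 2 ∧
      s' 0 = l.toList.foldl (g v) (s 0) ∧ ∀ x, k + 1 < x → s' x = s x := by
  induction l generalizing s with
  | nil => exact ⟨_, _, Run.loop_stop (by simpa [Expr.eval] using hsl), by simp [Expr.cost], by simp,
      fun _ _ => rfl⟩
  | cons x l _ ih =>
    set s₁ := Function.update s 0 (Val.cons x (Val.cons (s 0) v)) with hs₁
    obtain ⟨t, s₂, hr, ht, h0, hs⟩ := hc s₁
    have e₁ : s₁ 0 = Val.cons x (Val.cons (s 0) v) := by rw [hs₁, Function.update_self]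
    simp only [e₁, Val.hd_cons, Val.tl_cons] at h0
    set s₃ := Function.update s₂ (k + 1) l with hs₃
    have e₂ : s₂ (k + 1) = Val.cons x l := by
      rw [hs _ (by omega), hs₁, Function.update_of_ne (by omega), hsl]
    have e₃ : s₃ 0 = g v (s 0) x := by rw [hs₃, Function.update_of_ne (by omega), h0]
    obtain ⟨t', s', hr', ht', h0', hs'⟩ := ih s₃
      (by rw [hs₃, Function.update_of_ne (by omega), hs _ (by omega), hs₁,
        Function.update_of_ne (by omega), hsk])
      (by rw [hs₃, Function.update_self]) (fun l' hl' => by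
        rw [e₃]
        simpa using hQ (x :: l') (by simpa using hl'))
    have hfirst : Run (Cmd.assign 0 (Expr.cons (Expr.hd (Expr.var (k + 1)))
        (Expr.cons (Expr.var 0) (Expr.var k)))) s 7 s₁ := by
      have := Run.assign 0 (Expr.cons (Expr.hd (Expr.var (k + 1)))
        (Expr.cons (Expr.var 0) (Expr.var k))) s
      simpa [Expr.eval, Expr.cost, hsl, hsk] using this
    have hlast : Run (Cmd.assign (k + 1) (Expr.tl (Expr.var (k + 1)))) s₂ 3 s₃ := by
      have := Run.assign (k + 1) (Expr.tl (Expr.var (k + 1))) s₂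
      simpa [Expr.eval, Expr.cost, e₂] using this
    refine ⟨_, _, Run.loop_step (by simp [Expr.eval, hsl])
      (Run.seq hfirst (Run.seq hr hlast)) hr', ?_, by rw [h0', e₃]; simp, fun y hy => ?_⟩
    -- The empty prefix bounds the current accumulator, hence the argument of `c`.
    · have h1 := hQ [] List.nil_prefix
      have h2 : t ≤ p.eval ((Val.cons x l).size + Q + v.size + 2) := by
        refine ht.trans (p.eval_nat_mono ?_)
        rw [e₁]
        simp only [Val.size_cons, List.foldl_nil] at *
        omega
      have h3 : p.eval (l.size + Q + v.size + 2) ≤ p.eval ((Val.cons x l).size + Q + v.size + 2) :=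
        p.eval_nat_mono (by simp only [Val.size_cons]; omega)
      have h4 := Nat.mul_le_mul_left l.toList.length (Nat.add_le_add_right h3 12)
      simp only [Expr.cost, Val.toList_cons, List.length_cons, Nat.succ_mul]
      omega
    · rw [hs' _ hy, hs₃, Function.update_of_ne (by omega), hs _ (by omega), hs₁,
        Function.update_of_ne (by omega)]

/-- Folds over lists are polynomial-time if the size of the accumulator is polynomially bounded. -/
theorem PolyTime.foldl {l init : Val → Val} {g : Val → Val → Val → Val} (hl : PolyTime l)
    (hi : PolyTime init) (hg : PolyTime fun w => g w.tl.tl w.tl.hd w.hd) (q : Polynomial ℕ)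
    (hq : ∀ v l', l' <+: (l v).toList → (l'.foldl (g v) (init v)).size ≤ q.eval v.size) :
    PolyTime fun v => (l v).toList.foldl (g v) (init v) := by
  obtain ⟨c, B, p, hc, hp⟩ := hl
  obtain ⟨c₁, B₁, p₁, hc₁, hp₁⟩ := hi
  obtain ⟨c₂, B₂, p₂, hc₂, hp₂⟩ := hg
  set k := B + B₁ + B₂ + 1 with hk
  -- `p` bounds the number of passes, and the argument of `p₂` bounds the tree of entry, accumulator
  -- and environment that the loop body hands to `c₂`.
  refine PolyTime.of_computes (B := k + 1)
    (p := p + p₁ + p * (p₂.comp (p + q + Polynomial.X + 2) + 12) + 10) (q := q)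
    (c := Cmd.seq (Cmd.seq (Cmd.assign k (Expr.var 0)) c)
      (Cmd.seq (Cmd.assign (k + 1) (Expr.var 0)) (Cmd.seq (Cmd.assign 0 (Expr.var k))
        (Cmd.seq c₁ (Cmd.loop (Expr.var (k + 1)) (Cmd.seq
          (Cmd.assign 0 (Expr.cons (Expr.hd (Expr.var (k + 1)))
            (Expr.cons (Expr.var 0) (Expr.var k))))
          (Cmd.seq c₂ (Cmd.assign (k + 1) (Expr.tl (Expr.var (k + 1)))))))))))
    (fun s => ?_) fun v => hq v _ List.prefix_rfl
  obtain ⟨t, s', hr, ht, h0, hsk, hs⟩ := Run.save hc (show B < k by omega) s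
  set s₁ := Function.update s' (k + 1) (s' 0) with hs₁
  have e : s₁ k = s 0 := by rw [hs₁, Function.update_of_ne (by omega), hsk]
  set s₂ := Function.update s₁ 0 (s₁ k) with hs₂
  have e₂ : s₂ 0 = s 0 := by rw [hs₂, Function.update_self, e]
  obtain ⟨t₁, s₃, hr₁, ht₁, h0₁, hs₃⟩ := hc₁ s₂
  rw [e₂] at ht₁ h0₁
  obtain ⟨t₂, s₄, hr₂, ht₂, h0₂, hs₄⟩ := Run.foldl_loop hc₂ (show B₂ < k by omega) (s 0)
    (q.eval (s 0).size) (l (s 0)) s₃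
    (by rw [hs₃ _ (by omega), hs₂, Function.update_of_ne (by omega), e])
    (by rw [hs₃ _ (by omega), hs₂, Function.update_of_ne (by omega), hs₁, Function.update_self, h0])
    (by rw [h0₁]; exact hq (s 0))
  rw [h0₁] at h0₂
  refine ⟨_, _, Run.seq hr (Run.seq (Run.assign _ _ _) (Run.seq (Run.assign _ _ _)
    (Run.seq hr₁ hr₂))), ?_, h0₂, fun x hx => ?_⟩
  · have h1 : p₂.eval ((l (s 0)).size + q.eval (s 0).size + (s 0).size + 2) ≤
        p₂.eval (p.eval (s 0).size + q.eval (s 0).size + (s 0).size + 2) :=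
      p₂.eval_nat_mono (by have := hp (s 0); omega)
    have h2 := Nat.mul_le_mul ((Val.length_toList_le (l (s 0))).trans (hp (s 0)))
      (Nat.add_le_add_right h1 12)
    simp only [Expr.cost, Polynomial.eval_add, Polynomial.eval_mul, Polynomial.eval_comp,
      Polynomial.eval_ofNat, Polynomial.eval_X] at *
    omega
  · rw [hs₄ _ hx, hs₃ _ (by omega), hs₂, Function.update_of_ne (by omega), hs₁,
      Function.update_of_ne (by omega), hs _ (by omega) (by omega)]

/-- Serves to bound all intermediate accumulators of a fold by an invariant that may depend on the
number `j` of steps made; the step may use that `j` is less than the length of the list. -/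
theorem List.foldl_prefix_induction {α β : Type*} {f : β → α → β} {b : β} {l l' : List α}
    (P : ℕ → β → Prop) (h0 : P 0 b) (hs : ∀ j b x, x ∈ l → j < l.length → P j b → P (j + 1) (f b x))
    (h : l' <+: l) : P l'.length (l'.foldl f b) := by
  induction l' using List.reverseRecOn with
  | nil => exact h0
  | append_singleton l' x ih =>
    have hl : l'.length < l.length := by simpa using h.length_le
    rw [List.foldl_append, List.length_append]
    exact hs _ _ _ (h.subset (by simp)) hl (ih ((List.prefix_append _ _).trans h))

/-- Folds whose steps enlarge the accumulator by a polynomially bounded amount. -/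
theorem PolyTime.foldl_of_growth {l init : Val → Val} {g : Val → Val → Val → Val} (hl : PolyTime l)
    (hi : PolyTime init) (hg : PolyTime fun w => g w.tl.tl w.tl.hd w.hd) (r : Polynomial ℕ)
    (hr : ∀ v acc x, x ∈ (l v).toList → (g v acc x).size ≤ acc.size + r.eval v.size) :
    PolyTime fun v => (l v).toList.foldl (g v) (init v) := by
  obtain ⟨p, hp⟩ := hl.size_le
  obtain ⟨p₁, hp₁⟩ := hi.size_le
  refine PolyTime.foldl hl hi hg (p₁ + p * r) fun v l' hl' => ?_
  have h := List.foldl_prefix_induction (f := g v) (b := init v)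
    (fun j acc => acc.size ≤ (init v).size + j * r.eval v.size) (by simp)
    (fun j acc x hx _ h => by have := hr v acc x hx; rw [Nat.succ_mul]; omega) hl'
  have h1 := Nat.mul_le_mul_right (r.eval v.size)
    ((hl'.length_le.trans (Val.length_toList_le (l v))).trans (hp v))
  have h2 := hp₁ v
  simp only [Polynomial.eval_add, Polynomial.eval_mul]
  omega

/-! ## The reduction as a function on trees -/

namespace Val

/-- Concatenation of lists, the first one reversed. -/
def rapp (a b : Val) : Val := a.toList.foldl (fun acc x => cons x acc) b

/-- The tail of the list `a` behind the first `|b|` entries. -/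
def dropLen (a b : Val) : Val := b.toList.foldl (fun acc _ => acc.tl) a

/-- Comparison of the lengths of two lists. -/
def eqLen (a b : Val) : Val := cond (dropLen a b) (cond (dropLen b a) (cons nil nil) nil) nil

def and (a b : Val) : Val := cond a nil b

def eqLit (a b : Val) : Val := and (eqLen a.hd b.hd) (eqLen a.tl b.tl)

def eqClause (a b : Val) : Val :=
  and (eqLit a.hd b.hd) (and (eqLit a.tl.hd b.tl.hd) (eqLit a.tl.tl b.tl.tl))

def memClause (x l : Val) : Val :=
  l.toList.foldl (fun acc y => cond (eqClause x y) acc (cons nil nil)) nil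

/-- Without this the number of index bits would be logarithmic in the number of clauses, which is
not bounded in terms of the number of variables. -/
def dedup (l : Val) : Val :=
  l.toList.foldl (fun acc x => cond (memClause x acc) (cons x acc) acc) nil

def two (a : Val) : Val := cons nil (cons nil a)

/-- Extend each entry of the list `l` by `c` and by `c + 1`. -/
def double (c l : Val) : Val :=
  l.toList.foldl (fun acc e => cons (cons c e) (cons (cons (cons nil c) e) acc)) nil

def mkRule (h p : Val) : Val := cons h (cons p nil)

def single (a : Val) : Val := cons a nil

def pair (a b : Val) : Val := cons a (single b)

/-- One index bit: the state consists of the next atom, the list of all bit vectors and the list of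
rules. -/
def bitStep (C acc : Val) : Val :=
  cond (dropLen C acc.tl.hd) acc
    (cons (two acc.hd) (cons (double acc.hd acc.tl.hd)
      (cons (mkRule (pair acc.hd (cons nil acc.hd)) nil)
        (cons (mkRule (single acc.hd) (single nil))
          (cons (mkRule (single (cons nil acc.hd)) (single nil)) acc.tl.tl)))))

/-- The rule `← ¬ sat` and the four facts. -/
def baseRules : Val :=
  ofList [cons nil (cons nil (single (ofNat 0))), mkRule (single (ofNat 1)) nil,
    mkRule (single (ofNat 2)) nil, mkRule (single (ofNat 3)) nil, mkRule (single (ofNat 4)) nil]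

/-- One pass per clause is more than enough, since `bitStep` idles once there are as many vectors as
clauses. The numbers `0` to `4` belong to `sat` and the facts, so the first bit atom is `5`. -/
def bits (C : Val) : Val :=
  C.toList.foldl (fun acc _ => bitStep C acc) (cons (ofNat 5) (cons (single nil) baseRules))

/-- One propositional variable: the state consists of the next atom and the list of rules. -/
def varStep (acc : Val) : Val :=
  cons (two acc.hd) (cons (mkRule (pair acc.hd (cons nil acc.hd)) nil) acc.tl)

def vars (n st : Val) : Val := n.toList.foldl (fun acc _ => varStep acc) st

/-- Unary addition: sign `b` and variable `i` yield `c + 2 i + b`. The reversal in `rapp` is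
harmless because all entries are `nil`. -/
def litAtom (c l : Val) : Val := rapp l.tl (rapp l.tl (rapp l.hd c))

/-- The atom `b` is a fact that keeps the three rules of a vector distinct even if literals repeat;
an encoding must list each rule exactly once. -/
def mkClauseRule (e a b : Val) : Val := mkRule (single nil) (cons a (cons b e))

/-- One bit vector: the state consists of the list of the remaining clauses and the list of rules. -/
def clauseStep (c acc e : Val) : Val :=
  cons acc.hd.tl
    (cons (mkClauseRule e (cond acc.hd (ofNat 4) (litAtom c acc.hd.hd.hd)) (ofNat 1))
      (cons (mkClauseRule e (cond acc.hd (ofNat 4) (litAtom c acc.hd.hd.tl.hd)) (ofNat 2))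
        (cons (mkClauseRule e (cond acc.hd (ofNat 4) (litAtom c acc.hd.hd.tl.tl)) (ofNat 3)) acc.tl)))

def clauseRules (c l st : Val) : Val := l.toList.foldl (clauseStep c) st

/-- The rules for `n` variables and the list `C` of clauses, where `b` is the value of `bits`. -/
def assemble (n C b : Val) : Val :=
  (clauseRules b.hd b.tl.hd (cons C (vars n (cons b.hd b.tl.tl)).tl)).tl

def reduction (v : Val) : Val := assemble v.hd (dedup v.tl) (bits (dedup v.tl))

theorem size_rapp (a b : Val) : (rapp a b).size + 1 = a.size + b.size := by
  induction a generalizing b with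
  | nil => simp [rapp]; omega
  | cons x a _ ih =>
    have := ih (cons x b)
    simp only [rapp, toList_cons, List.foldl_cons, size_cons] at *
    omega

theorem size_litAtom_le (c l : Val) : (litAtom c l).size ≤ 3 * l.size + c.size := by
  have h1 := size_rapp l.tl (rapp l.tl (rapp l.hd c))
  have h2 := size_rapp l.tl (rapp l.hd c)
  have h3 := size_rapp l.hd c
  have := size_hd_le l
  have := size_tl_le l
  rw [litAtom]; omega

end Val

/-! ### Polynomial time for the components of the reduction -/

namespace PolyTime

open Val (size_le_of_mem_toList size_cond_le size_tl_le size_cons size_nil)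

variable {f g h k : Val → Val}

@[fun_prop]
theorem rapp (hf : PolyTime f) (hg : PolyTime g) : PolyTime fun v => Val.rapp (f v) (g v) := by
  obtain ⟨p, hp⟩ := hf.size_le
  refine PolyTime.foldl_of_growth (g := fun v acc x => Val.cons x acc) hf hg (by fun_prop) (p + 1)
    fun v acc x hx => ?_
  have := (size_le_of_mem_toList hx).trans (hp v)
  simp only [size_cons, Polynomial.eval_add, Polynomial.eval_one]; omega

@[fun_prop]
theorem dropLen (hf : PolyTime f) (hg : PolyTime g) : PolyTime fun v => Val.dropLen (f v) (g v) :=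
  PolyTime.foldl_of_growth (g := fun v acc x => acc.tl) hg hf (by fun_prop) 0
    fun v acc x _ => by simpa using size_tl_le acc

@[fun_prop]
theorem eqLen (hf : PolyTime f) (hg : PolyTime g) : PolyTime fun v => Val.eqLen (f v) (g v) := by
  unfold Val.eqLen; fun_prop

@[fun_prop]
theorem and (hf : PolyTime f) (hg : PolyTime g) : PolyTime fun v => Val.and (f v) (g v) := by
  unfold Val.and; fun_prop

@[fun_prop]
theorem eqLit (hf : PolyTime f) (hg : PolyTime g) : PolyTime fun v => Val.eqLit (f v) (g v) := by
  unfold Val.eqLit; fun_prop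

@[fun_prop]
theorem eqClause (hf : PolyTime f) (hg : PolyTime g) : PolyTime fun v => Val.eqClause (f v) (g v) := by
  unfold Val.eqClause; fun_prop

@[fun_prop]
theorem memClause (hf : PolyTime f) (hg : PolyTime g) :
    PolyTime fun v => Val.memClause (f v) (g v) := by
  refine PolyTime.foldl_of_growth
    (g := fun v acc y => Val.cond (Val.eqClause (f v) y) acc (Val.cons .nil .nil)) hg (.const _)
    (by fun_prop) 3 fun v acc x _ => (size_cond_le _ _ _).trans ?_
  simp

@[fun_prop]
theorem dedup (hf : PolyTime f) : PolyTime fun v => Val.dedup (f v) := by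
  obtain ⟨p, hp⟩ := hf.size_le
  refine PolyTime.foldl_of_growth
    (g := fun v acc x => Val.cond (Val.memClause x acc) (Val.cons x acc) acc) hf (.const _)
    (by fun_prop) (p + 1) fun v acc x hx => (size_cond_le _ _ _).trans ?_
  have := (size_le_of_mem_toList hx).trans (hp v)
  simp only [size_cons, Polynomial.eval_add, Polynomial.eval_one, sup_le_iff]; omega

@[fun_prop]
theorem two (hf : PolyTime f) : PolyTime fun v => Val.two (f v) := by
  unfold Val.two; fun_prop

@[fun_prop]
theorem double (hf : PolyTime f) (hg : PolyTime g) : PolyTime fun v => Val.double (f v) (g v) := by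
  obtain ⟨p, hp⟩ := hf.size_le
  obtain ⟨q, hq⟩ := hg.size_le
  refine PolyTime.foldl_of_growth (g := fun v acc e => Val.cons (Val.cons (f v) e)
    (Val.cons (Val.cons (Val.cons .nil (f v)) e) acc)) hg (.const _) (by fun_prop)
    (2 * p + 2 * q + 6) fun v acc x hx => ?_
  have := (size_le_of_mem_toList hx).trans (hq v)
  have := hp v
  simp only [size_cons, size_nil, Polynomial.eval_add, Polynomial.eval_mul, Polynomial.eval_ofNat]
  omega

@[fun_prop]
theorem single (hf : PolyTime f) : PolyTime fun v => Val.single (f v) := by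
  unfold Val.single; fun_prop

@[fun_prop]
theorem pair (hf : PolyTime f) (hg : PolyTime g) : PolyTime fun v => Val.pair (f v) (g v) := by
  unfold Val.pair; fun_prop

@[fun_prop]
theorem mkRule (hf : PolyTime f) (hg : PolyTime g) : PolyTime fun v => Val.mkRule (f v) (g v) := by
  unfold Val.mkRule; fun_prop

@[fun_prop]
theorem bitStep (hf : PolyTime f) (hg : PolyTime g) : PolyTime fun v => Val.bitStep (f v) (g v) := by
  unfold Val.bitStep; fun_prop

@[fun_prop]
theorem varStep (hf : PolyTime f) : PolyTime fun v => Val.varStep (f v) := by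
  unfold Val.varStep; fun_prop

@[fun_prop]
theorem litAtom (hf : PolyTime f) (hg : PolyTime g) : PolyTime fun v => Val.litAtom (f v) (g v) := by
  unfold Val.litAtom; fun_prop

@[fun_prop]
theorem mkClauseRule (hf : PolyTime f) (hg : PolyTime g) (hh : PolyTime h) :
    PolyTime fun v => Val.mkClauseRule (f v) (g v) (h v) := by
  unfold Val.mkClauseRule; fun_prop

@[fun_prop]
theorem clauseStep (hf : PolyTime f) (hg : PolyTime g) (hh : PolyTime h) :
    PolyTime fun v => Val.clauseStep (f v) (g v) (h v) := by
  unfold Val.clauseStep; fun_prop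

end PolyTime

/-! ### Growth of the list of bit vectors -/

namespace Val

theorem toList_eq_nil {v : Val} : v.toList = [] ↔ v = nil := by
  cases v <;> simp

theorem toList_tl (v : Val) : v.tl.toList = v.toList.tail := by
  cases v <;> rfl

theorem toList_dropLen (a b : Val) : (dropLen a b).toList = a.toList.drop b.toList.length := by
  induction b generalizing a with
  | nil => rfl
  | cons x b _ ih =>
    have := ih a.tl
    simp only [dropLen, toList_cons, List.foldl_cons, List.length_cons] at *
    rw [this, toList_tl, List.drop_tail]

theorem dropLen_eq_nil {a b : Val} : dropLen a b = nil ↔ a.toList.length ≤ b.toList.length := by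
  rw [← toList_eq_nil, toList_dropLen, List.drop_eq_nil_iff]

theorem toList_double (c l : Val) : (double c l).toList =
    l.toList.reverse.flatMap fun e => [cons c e, cons (cons nil c) e] := by
  have : ∀ (l : List Val) (a : Val),
      (l.foldl (fun acc e => cons (cons c e) (cons (cons (cons nil c) e) acc)) a).toList =
        (l.reverse.flatMap fun e => [cons c e, cons (cons nil c) e]) ++ a.toList := by
    intro l
    induction l with
    | nil => simp
    | cons x l ih => intro a; rw [List.foldl_cons, ih]; simp
  simpa [double] using this l.toList nil

theorem length_double (c l : Val) : (double c l).toList.length = 2 * l.toList.length := by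
  simp [toList_double, List.length_flatMap, mul_comm]

theorem size_le_of_forall_mem {v : Val} {M : ℕ} (h : ∀ x ∈ v.toList, x.size ≤ M) :
    v.size ≤ v.toList.length * (M + 1) + 1 := by
  induction v with
  | nil => simp
  | cons x y _ ih =>
    have h1 := h x (by simp)
    have h2 := ih fun z hz => h z (by simp [hz])
    simp only [size_cons, toList_cons, List.length_cons, Nat.add_one_mul]; omega

/-- Bounds on the state of the computation of the bit vectors after `j` steps. -/
structure BitBound (m j : ℕ) (acc : Val) : Prop where
  hd : acc.hd.size ≤ 11 + 4 * j
  len : acc.tl.hd.toList.length ≤ 2 * m + 1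
  mem : ∀ e ∈ acc.tl.hd.toList, e.size ≤ 1 + j * (4 * m + 14)
  rules : acc.tl.tl.size ≤ 100 + j * (16 * m + 100)

theorem BitBound.bitStep {C acc : Val} {j : ℕ} (hj : j < C.toList.length)
    (h : BitBound C.toList.length j acc) :
    BitBound C.toList.length (j + 1) (bitStep C acc) := by
  obtain ⟨h1, h2, h3, h4⟩ := h
  rw [Val.bitStep]
  cases hd : Val.dropLen C acc.tl.hd with
  | nil =>
    refine ⟨?_, h2, fun e he => (h3 e he).trans ?_, h4.trans ?_⟩
    · simp only [cond_nil]; omega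
    · gcongr; omega
    · gcongr; omega
  | cons a b =>
    -- The list is doubled only while it is shorter than `C`, which keeps its length linear in spite
    -- of the repeated doubling.
    have hlt : acc.tl.hd.toList.length < C.toList.length := by
      by_contra hle
      rw [dropLen_eq_nil.2 (not_lt.1 hle)] at hd
      simp at hd
    refine ⟨?_, ?_, ?_, ?_⟩
    · simp only [cond_cons, hd_cons, two, size_cons, size_nil]; omega
    · simp only [cond_cons, tl_cons, hd_cons, length_double]; omega
    · simp only [cond_cons, tl_cons, hd_cons, toList_double, List.mem_flatMap, List.mem_reverse]
      rintro e ⟨e', he', he⟩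
      have := h3 e' he'
      have : e.size ≤ acc.hd.size + 3 + e'.size := by
        simp only [List.mem_cons, List.not_mem_nil, or_false] at he
        rcases he with rfl | rfl <;> (simp only [size_cons, size_nil]; omega)
      rw [Nat.add_one_mul j]; omega
    · simp only [cond_cons, tl_cons, size_cons, mkRule, pair, single, size_nil, Nat.add_one_mul j]
      omega

end Val

namespace PolyTime

open Val (size_le_of_mem_toList size_cond_le size_tl_le size_hd_le size_cons size_nil)

-- Doubling is not growth by a bounded amount, so `PolyTime.foldl_of_growth` does not apply; the
-- invariant `BitBound` bounds the components of the state instead.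
@[fun_prop]
theorem bits {f : Val → Val} (hf : PolyTime f) : PolyTime fun v => Val.bits (f v) := by
  obtain ⟨p, hp⟩ := hf.size_le
  refine PolyTime.foldl (g := fun v acc _ => Val.bitStep (f v) acc) hf (.const _) (by fun_prop)
    ((11 + 4 * p) + ((2 * p + 1) * (1 + p * (4 * p + 14) + 1) + 1) + (100 + p * (16 * p + 100)) + 2)
    fun v l' hl' => ?_
  obtain ⟨h1, h2, h3, h4⟩ := List.foldl_prefix_induction (f := fun acc _ => Val.bitStep (f v) acc)
    (b := Val.cons (Val.ofNat 5) (Val.cons (Val.single .nil) Val.baseRules))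
    (Val.BitBound (f v).toList.length)
    ⟨by simp [Val.ofNat, Val.ofList, List.replicate], by simp [Val.single],
      by simp [Val.single], by
        simp [Val.baseRules, Val.ofNat, Val.ofList, List.replicate, Val.mkRule, Val.single]⟩
    (fun j b x _ hj h => h.bitStep hj) hl'
  have hm := (Val.length_toList_le (f v)).trans (hp v)
  have hj := hl'.length_le.trans hm
  generalize l'.foldl (fun acc _ => Val.bitStep (f v) acc) _ = acc at *
  generalize l'.length = j at *
  generalize (f v).toList.length = m at *
  have h5 : acc.tl.hd.size ≤ (2 * p.eval v.size + 1) *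
      (1 + p.eval v.size * (4 * p.eval v.size + 14) + 1) + 1 :=
    (Val.size_le_of_forall_mem h3).trans (by gcongr; omega)
  have h6 : acc.tl.tl.size ≤ 100 + p.eval v.size * (16 * p.eval v.size + 100) :=
    h4.trans (by gcongr)
  have h7 : acc.size ≤ acc.hd.size + acc.tl.size + 1 := by
    cases acc <;> simp
  have h8 : acc.tl.size ≤ acc.tl.hd.size + acc.tl.tl.size + 1 := by
    cases acc.tl <;> simp
  simp only [Polynomial.eval_add, Polynomial.eval_mul, Polynomial.eval_one, Polynomial.eval_ofNat]
  omega

-- The new rule contains the atom counter of the accumulator, so the counter needs a bound of its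
-- own.
@[fun_prop]
theorem vars {f g : Val → Val} (hf : PolyTime f) (hg : PolyTime g) :
    PolyTime fun v => Val.vars (f v) (g v) := by
  obtain ⟨p, hp⟩ := hf.size_le
  obtain ⟨q, hq⟩ := hg.size_le
  refine PolyTime.foldl (g := fun v acc _ => Val.varStep acc) hf hg (by fun_prop)
    ((q + 4 * p) + (q + p * (2 * q + 8 * p + 10)) + 1) fun v l' hl' => ?_
  have hm := (Val.length_toList_le (f v)).trans (hp v)
  obtain ⟨h1, h2⟩ := List.foldl_prefix_induction (f := fun acc _ => Val.varStep acc) (b := g v)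
    (fun j acc => acc.hd.size ≤ q.eval v.size + 4 * j ∧
      acc.tl.size ≤ q.eval v.size + j * (2 * q.eval v.size + 8 * p.eval v.size + 10))
    ⟨by simpa using (size_hd_le _).trans (hq v), by simpa using (size_tl_le _).trans (hq v)⟩
    (fun j acc x _ hj h => by
      simp only [Val.varStep, Val.tl_cons, Val.hd_cons, Val.two, size_cons, size_nil, Val.mkRule,
        Val.pair, Val.single, Nat.add_one_mul j]
      omega) hl'
  have hj := hl'.length_le.trans hm
  generalize l'.foldl (fun acc _ => Val.varStep acc) (g v) = acc at *
  generalize l'.length = j at *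
  have h3 := Nat.mul_le_mul_right (2 * q.eval v.size + 8 * p.eval v.size + 10) hj
  have h7 : acc.size ≤ acc.hd.size + acc.tl.size + 1 := by
    cases acc <;> simp
  simp only [Polynomial.eval_add, Polynomial.eval_mul, Polynomial.eval_one, Polynomial.eval_ofNat]
  omega

@[fun_prop]
theorem clauseRules {f g h : Val → Val} (hf : PolyTime f) (hg : PolyTime g) (hh : PolyTime h) :
    PolyTime fun v => Val.clauseRules (f v) (g v) (h v) := by
  obtain ⟨p, hp⟩ := hf.size_le
  obtain ⟨q, hq⟩ := hg.size_le
  obtain ⟨r, hr⟩ := hh.size_le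
  refine PolyTime.foldl (g := fun v acc e => Val.clauseStep (f v) acc e) hg hh (by fun_prop)
    (r + (r + q * (9 * r + 3 * q + 3 * p + 100)) + 1) fun v l' hl' => ?_
  have hm := (Val.length_toList_le (g v)).trans (hq v)
  obtain ⟨h1, h2⟩ := List.foldl_prefix_induction
    (f := fun acc e => Val.clauseStep (f v) acc e) (b := h v)
    (fun j acc => acc.hd.size ≤ r.eval v.size ∧ acc.tl.size ≤ r.eval v.size +
      j * (9 * r.eval v.size + 3 * q.eval v.size + 3 * p.eval v.size + 100))
    ⟨(size_hd_le _).trans (hr v), by simpa using (size_tl_le _).trans (hr v)⟩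
    (fun j acc x hx hj h => by
      have hc : ∀ l : Val, l.size ≤ acc.hd.size →
          (Val.cond acc.hd (Val.ofNat 4) (Val.litAtom (f v) l)).size ≤
            9 + 3 * acc.hd.size + (f v).size := fun l hl => by
        have h1 := Val.size_litAtom_le (f v) l
        have h2 := size_cond_le acc.hd (Val.ofNat 4) (Val.litAtom (f v) l)
        have h3 : (Val.ofNat 4).size = 9 := rfl
        omega
      have e := size_hd_le acc.hd
      have h1 := hc acc.hd.hd.hd ((size_hd_le _).trans e)
      have h2 := hc acc.hd.hd.tl.hd ((size_hd_le _).trans ((size_tl_le _).trans e))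
      have h3 := hc acc.hd.hd.tl.tl ((size_tl_le _).trans ((size_tl_le _).trans e))
      have h4 := size_tl_le acc.hd
      have h5 := (size_le_of_mem_toList hx).trans (hq v)
      have h6 := hp v
      have e1 : (Val.ofNat 1).size = 3 := rfl
      have e2 : (Val.ofNat 2).size = 5 := rfl
      have e3 : (Val.ofNat 3).size = 7 := rfl
      simp only [Val.clauseStep, Val.tl_cons, Val.hd_cons, size_cons, size_nil, Val.mkRule,
        Val.mkClauseRule, Val.single, Nat.add_one_mul j]
      omega) hl'
  have hj := hl'.length_le.trans hm
  generalize l'.foldl (fun acc e => Val.clauseStep (f v) acc e) (h v) = acc at *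
  generalize l'.length = j at *
  have h3 := Nat.mul_le_mul_right (9 * r.eval v.size + 3 * q.eval v.size + 3 * p.eval v.size + 100) hj
  have h7 : acc.size ≤ acc.hd.size + acc.tl.size + 1 := by
    cases acc <;> simp
  simp only [Polynomial.eval_add, Polynomial.eval_mul, Polynomial.eval_one, Polynomial.eval_ofNat]
  omega

theorem reduction : PolyTime Val.reduction := by
  have : PolyTime fun v => Val.reduction v := by
    unfold Val.reduction Val.assemble; fun_prop
  exact this

end PolyTime

/-! ## The program of the reduction -/

/-- A graph is acyclic if it has a ranking of its vertices such that each vertex has at most one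
neighbour that is not ranked higher. -/
theorem SimpleGraph.isAcyclic_of_rank {V : Type*} {G : SimpleGraph V} (rank : V → ℕ)
    (h : ∀ v w w', G.Adj v w → G.Adj v w' → rank w ≤ rank v → rank w' ≤ rank v → w = w') :
    G.IsAcyclic := by
  classical
  intro u c hc
  obtain ⟨v, hv, hmax⟩ := c.support.toFinset.exists_max_image rank
    ⟨u, by simp⟩
  rw [List.mem_toFinset] at hv
  -- At a vertex of maximal rank on the cycle neither of the two cycle neighbours is ranked higher,
  -- so they would coincide.
  have hc' := hc.rotate hv
  have hle : ∀ w ∈ (c.rotate v hv).support, rank w ≤ rank v := fun w hw =>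
    hmax w (by
      rw [List.mem_toFinset]
      simpa using hw)
  exact hc'.snd_ne_penultimate (h v _ _ (SimpleGraph.Walk.adj_snd hc'.not_nil)
    (SimpleGraph.Walk.adj_penultimate hc'.not_nil).symm
    (hle _ (SimpleGraph.Walk.getVert_mem_support _ _))
    (hle _ (SimpleGraph.Walk.getVert_mem_support _ _)))

/-- The atoms of the program, for index bits `ι` and propositional variables `κ`. -/
inductive Atom (ι κ : Type) : Type
  | sat : Atom ι κ
  | fact : Fin 4 → Atom ι κ
  | bit : ι → Bool → Atom ι κ
  | lit : κ → Bool → Atom ι κ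
  deriving DecidableEq

/-- Names for the rules of the program. -/
inductive RuleIx (ι κ : Type) : Type
  | con : RuleIx ι κ
  | fact : Fin 4 → RuleIx ι κ
  | choice : κ → RuleIx ι κ
  | bitChoice : ι → RuleIx ι κ
  | satur : ι → Bool → RuleIx ι κ
  | clause : (ι → Bool) → Fin 3 → RuleIx ι κ

/-- The atom for a literal, where `none` stands for truth. -/
def Atom.ofLit {ι κ : Type} : Option (κ × Bool) → Atom ι κ
  | none => Atom.fact 3
  | some l => Atom.lit l.1 l.2

namespace RuleIx

variable {ι κ : Type}

theorem _root_.Atom.ofLit_ne_sat (l : Option (κ × Bool)) : (Atom.ofLit l : Atom ι κ) ≠ Atom.sat := by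
  cases l <;> simp [Atom.ofLit]

theorem _root_.Atom.ofLit_ne_bit (l : Option (κ × Bool)) (j : ι) (b : Bool) :
    (Atom.ofLit l : Atom ι κ) ≠ Atom.bit j b := by
  cases l <;> simp [Atom.ofLit]

theorem _root_.Atom.ofLit_ne_fact (l : Option (κ × Bool)) (p : Fin 3) :
    (Atom.ofLit l : Atom ι κ) ≠ Atom.fact p.castSucc := by
  cases l with
  | none => simp only [Atom.ofLit, ne_eq, Atom.fact.injEq, Fin.ext_iff]; simp; omega
  | some l => simp [Atom.ofLit]

variable [Fintype ι] [DecidableEq ι] [DecidableEq κ]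

def head : RuleIx ι κ → Finset (Atom ι κ)
  | con => ∅
  | fact q => {Atom.fact q}
  | choice i => {Atom.lit i false, Atom.lit i true}
  | bitChoice j => {Atom.bit j false, Atom.bit j true}
  | satur j b => {Atom.bit j b}
  | clause _ _ => {Atom.sat}

def pos (A : (ι → Bool) → Fin 3 → Option (κ × Bool)) : RuleIx ι κ → Finset (Atom ι κ)
  | satur _ _ => {Atom.sat}
  | clause β p => {Atom.ofLit (A β p), Atom.fact p.castSucc} ∪
      Finset.univ.image fun j => Atom.bit j (β j)
  | _ => ∅

def neg : RuleIx ι κ → Finset (Atom ι κ)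
  | con => {Atom.sat}
  | _ => ∅

theorem bit_mem_pos_clause {A : (ι → Bool) → Fin 3 → Option (κ × Bool)} {β : ι → Bool} {p : Fin 3}
    {j : ι} {b : Bool} : Atom.bit j b ∈ (clause β p : RuleIx ι κ).pos A ↔ β j = b := by
  simp [pos, (Atom.ofLit_ne_bit _ _ _).symm]

theorem fact_mem_pos_clause {A : (ι → Bool) → Fin 3 → Option (κ × Bool)} {β : ι → Bool}
    {p q : Fin 3} : Atom.fact q.castSucc ∈ (clause β p : RuleIx ι κ).pos A ↔ q = p := by
  simp [pos, (Atom.ofLit_ne_fact _ _).symm]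

/-- The rule with a given name, over the atoms `α`. -/
def toRule {α : Type} (e : Atom ι κ ≃ α) (A : (ι → Bool) → Fin 3 → Option (κ × Bool))
    (x : RuleIx ι κ) : Rule α where
  head := x.head.map e.toEmbedding
  pos := (x.pos A).map e.toEmbedding
  neg := x.neg.map e.toEmbedding
  disjoint_head_pos := by
    rw [Finset.disjoint_map]
    cases x <;> simp [head, pos, (Atom.ofLit_ne_sat _).symm]
  disjoint_head_neg := by
    rw [Finset.disjoint_map]
    cases x <;> simp [head, neg]
  disjoint_pos_neg := by
    rw [Finset.disjoint_map]
    cases x <;> simp [neg, pos]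

variable {α : Type} {e : Atom ι κ ≃ α} {A : (ι → Bool) → Fin 3 → Option (κ × Bool)}

/-- The head identifies all rules but two kinds: the body `sat` tells saturation from bit choice,
and the bits and the fact in the body of a clause rule recover `β` and `p`. -/
theorem toRule_injective : Function.Injective (toRule e A) := by
  intro x y h
  have hh : x.head = y.head := Finset.map_injective _ (congrArg Rule.head h)
  have hp : x.pos A = y.pos A := Finset.map_injective _ (congrArg Rule.pos h)
  rw [Finset.ext_iff] at hh hp
  cases x with
  | con =>
    cases y with
    | con => rfl
    | fact q => simpa [head] using hh (Atom.fact q)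
    | choice i => simpa [head] using hh (Atom.lit i true)
    | bitChoice j => simpa [head] using hh (Atom.bit j true)
    | satur j b => simpa [head] using hh (Atom.bit j b)
    | clause β p => simpa [head] using hh Atom.sat
  | fact q =>
    have := hh (Atom.fact q)
    cases y <;> simp [head] at this
    rw [this]
  | choice i =>
    have := hh (Atom.lit i true)
    cases y <;> simp [head] at this
    rw [this]
  | bitChoice j =>
    have := hh (Atom.bit j true)
    have h' := hp Atom.sat
    cases y <;> simp [head, pos] at this h'
    rw [this]
  | satur j b =>
    have := hh (Atom.bit j b)
    have h' := hp Atom.sat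
    cases y <;> simp [head, pos] at this h'
    rw [this.1, this.2]
  | clause β p =>
    cases y with
    | clause β' p' =>
      have h1 : ∀ j, β' j = β j := fun j => by
        rw [← bit_mem_pos_clause (A := A) (p := p'), ← hp, bit_mem_pos_clause]
      have h2 : p = p' := by
        rw [← fact_mem_pos_clause (A := A) (β := β'), ← hp, fact_mem_pos_clause]
      rw [funext h1, h2]
    | _ =>
      have := hh Atom.sat
      simp [head] at this

theorem mem_atoms_toRule [DecidableEq α] {x : RuleIx ι κ} {a : Atom ι κ} :
    e a ∈ (toRule e A x).atoms ↔ a ∈ x.head ∨ a ∈ x.pos A ∨ a ∈ x.neg := by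
  simp [Rule.atoms, toRule]

/-- This makes the graph sparse: only a choice rule contains two literal atoms. -/
theorem lit_mem_atoms_toRule [DecidableEq α] {x : RuleIx ι κ} {i : κ} {b : Bool} :
    e (Atom.lit i b) ∈ (toRule e A x).atoms ↔
      x = choice i ∨ ∃ β p, x = clause β p ∧ A β p = some (i, b) := by
  rw [mem_atoms_toRule]
  cases x with
  | choice i' => cases b <;> simp [head, pos, neg, eq_comm]
  | clause β p =>
    cases h : A β p <;> simp [head, pos, neg, Atom.ofLit, h, Prod.ext_iff, eq_comm]
  | _ => simp [head, pos, neg]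

end RuleIx

/-- Truth of a literal, where `none` stands for truth. -/
def litHolds {κ : Type} (σ : κ → Bool) : Option (κ × Bool) → Prop
  | none => True
  | some l => σ l.1 = l.2

/-! ### Answer sets of the program -/

namespace Program

open RuleIx

variable {ι κ α : Type} [Fintype ι] [DecidableEq ι] [DecidableEq κ]
  {e : Atom ι κ ≃ α} {A : (ι → Bool) → Fin 3 → Option (κ × Bool)} {P : Program α}

/-- Negation occurs only in `← ¬ sat`. If `sat ∉ I`, this rule becomes unsatisfiable in the reduct;
otherwise it is deleted, and `I` has no further influence. -/
theorem isModel_reduct_iff (hP : ∀ r, r ∈ P ↔ ∃ x, r = toRule e A x) (I J : Set α) :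
    IsModel (P.reduct I) J ↔ e Atom.sat ∈ I ∧ (∀ q, e (Atom.fact q) ∈ J) ∧
      (∀ i, e (Atom.lit i false) ∈ J ∨ e (Atom.lit i true) ∈ J) ∧
      (∀ j, e (Atom.bit j false) ∈ J ∨ e (Atom.bit j true) ∈ J) ∧
      (∀ j b, e Atom.sat ∈ J → e (Atom.bit j b) ∈ J) ∧
      ∀ β p, (∀ j, e (Atom.bit j (β j)) ∈ J) → e (Atom.ofLit (A β p)) ∈ J →
        e (Atom.fact p.castSucc) ∈ J → e Atom.sat ∈ J := by
  have key : IsModel (P.reduct I) J ↔ ∀ x : RuleIx ι κ, (∀ a ∈ x.neg, e a ∉ I) →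
      (∃ a ∈ x.head, e a ∈ J) ∨ ∃ a ∈ x.pos A, e a ∉ J := by
    constructor
    · intro h x hx
      have := h _ ⟨_, (hP _).2 ⟨x, rfl⟩, by simpa [toRule, -Finset.mem_map_equiv] using hx, rfl⟩
      simpa [Rule.SatisfiedBy, Rule.dropNeg, toRule, -Finset.mem_map_equiv] using this
    · rintro h _ ⟨r, hr, hI, rfl⟩
      obtain ⟨x, rfl⟩ := (hP r).1 hr
      have := h x (by simpa [toRule, -Finset.mem_map_equiv] using hI)
      simpa [Rule.SatisfiedBy, Rule.dropNeg, toRule, -Finset.mem_map_equiv] using this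
  rw [key]
  constructor
  · intro h
    refine ⟨?_, fun q => ?_, fun i => ?_, fun j => ?_, fun j b hs => ?_, fun β p h1 h2 h3 => ?_⟩
    · by_contra hs
      simpa [head, pos] using h con (by simpa [neg] using hs)
    · simpa [head, pos] using h (fact q) (by simp [neg])
    · simpa [head, pos] using h (choice i) (by simp [neg])
    · simpa [head, pos] using h (bitChoice j) (by simp [neg])
    · simpa [head, pos, hs] using h (satur j b) (by simp [neg])
    · simpa [head, pos, h1, h2, h3] using h (clause β p) (by simp [neg])
  · rintro ⟨h1, h2, h3, h4, h5, h6⟩ x hx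
    cases x with
    | con => simp [neg, h1] at hx
    | fact q => simpa [head, pos] using h2 q
    | choice i => simpa [head, pos] using h3 i
    | bitChoice j => simpa [head, pos] using h4 j
    | satur j b => simpa [head, pos, or_iff_not_imp_right] using h5 j b
    | clause β p =>
      by_cases h : ∃ a ∈ (clause β p : RuleIx ι κ).pos A, e a ∉ J
      · exact Or.inr h
      · push Not at h
        exact Or.inl ⟨Atom.sat, by simp [head], h6 β p (fun j => h _ (by simp [pos]))
          (h _ (by simp [pos])) (h _ (by simp [pos]))⟩

/-- The saturation argument: an answer set contains `sat` and all bit atoms, and a vector whose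
clause is false under its assignment is the same as a smaller model of the reduct. -/
theorem consistent_iff (hP : ∀ r, r ∈ P ↔ ∃ x, r = toRule e A x) :
    P.Consistent ↔ ∃ σ : κ → Bool, ∀ β, ∃ p, litHolds σ (A β p) := by
  classical
  constructor
  · rintro ⟨I, hI, hmin⟩
    obtain ⟨h1, h2, h3, -, h5, -⟩ := (isModel_reduct_iff hP I I).1 hI
    refine ⟨fun i => decide (e (Atom.lit i true) ∈ I), ?_⟩
    by_contra! hβ
    obtain ⟨β, hβ⟩ := hβ
    set σ : κ → Bool := fun i => decide (e (Atom.lit i true) ∈ I) with hσ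
    -- The competitor for the falsified clause of `β`: only the bits of `β`, and no `sat`. No clause
    -- rule fires in it, because the bits of another vector are incomplete.
    let T : Set (Atom ι κ) := {a | (∃ q, a = Atom.fact q) ∨ (∃ i, a = Atom.lit i (σ i)) ∨
      ∃ j, a = Atom.bit j (β j)}
    have hT : ∀ a, e a ∈ e '' T ↔ a ∈ T := fun a => e.injective.mem_set_image
    have hle : e '' T ⊆ I := by
      rintro _ ⟨a, ha, rfl⟩
      rcases ha with ⟨q, rfl⟩ | ⟨i, rfl⟩ | ⟨j, rfl⟩
      · exact h2 q
      · by_cases hi : e (Atom.lit i true) ∈ I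
        · simp [hσ, hi]
        · simpa [hσ, hi] using h3 i
      · exact h5 j _ h1
    have hsat : e Atom.sat ∈ e '' T := hmin ((isModel_reduct_iff hP I _).2
      ⟨h1, fun q => by simp [T], fun i => by cases h : σ i <;> simp [T, h],
        fun j => by cases h : β j <;> simp [T, h],
        fun j b h => by simp [T] at h, fun β' p hb hl _ => by
          have : β' = β := funext fun j => by simpa [hT, T] using hb j
          subst this
          refine absurd ?_ (hβ p)
          rw [hT] at hl
          cases hA : A β' p with
          | none => trivial
          | some l => simpa [hA, T, Atom.ofLit, litHolds, eq_comm] using hl⟩) hle h1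
    simp [T] at hsat
  · rintro ⟨σ, hσ⟩
    -- The saturated set: everything but the literals that are false under `σ`.
    let T : Set (Atom ι κ) := {a | ∀ i, a ≠ Atom.lit i (!σ i)}
    have hT : ∀ a, e a ∈ e '' T ↔ a ∈ T := fun a => e.injective.mem_set_image
    refine ⟨e '' T, (isModel_reduct_iff hP _ _).2 ⟨by simp [T], by simp [T], fun i => ?_,
      by simp [T], by simp [T], by simp [T]⟩, fun J hJ hle => ?_⟩
    · cases h : σ i <;> simp only [hT, T, Set.mem_ofPred_eq, ne_eq, Atom.lit.injEq] <;> grind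
    · obtain ⟨-, h2, h3, h4, h5, h6⟩ := (isModel_reduct_iff hP _ _).1 hJ
      have hlit : ∀ i, e (Atom.lit i (σ i)) ∈ J := by
        intro i
        have h : ∀ b, e (Atom.lit i b) ∈ J → b = σ i := fun b hb => by
          have := (hT _).1 (hle hb) i
          simpa using this
        rcases h3 i with hi | hi <;> simpa [← h _ hi] using hi
      -- Any smaller model still contains the bits of some vector; a true literal of its clause
      -- derives `sat`, and saturation restores the remaining bits.
      choose β hβ using fun j => show ∃ b, e (Atom.bit j b) ∈ J from
        (h4 j).elim (fun h => ⟨_, h⟩) fun h => ⟨_, h⟩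
      obtain ⟨p, hp⟩ := hσ β
      have hsat : e Atom.sat ∈ J := by
        refine h6 β p hβ ?_ (h2 _)
        cases hA : A β p with
        | none => exact h2 3
        | some l =>
          rw [hA] at hp
          have := hlit l.1
          rwa [show σ l.1 = l.2 from hp] at this
      rintro _ ⟨a, ha, rfl⟩
      cases a with
      | sat => exact hsat
      | fact q => exact h2 q
      | bit j b => exact h5 j b hsat
      | lit i b =>
        have : b = σ i := by simpa [T] using ha i
        exact this ▸ hlit i

theorem atoms_eq_univ [DecidableEq α] [Fintype α] (hP : ∀ r, r ∈ P ↔ ∃ x, r = toRule e A x) :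
    P.atoms = Finset.univ := by
  refine Finset.eq_univ_of_forall fun a => ?_
  obtain ⟨a, rfl⟩ := e.surjective a
  have h : ∀ x, e a ∈ (toRule e A x).atoms → e a ∈ P.atoms := fun x hx =>
    Finset.mem_biUnion.2 ⟨_, (hP _).2 ⟨x, rfl⟩, hx⟩
  cases a with
  | sat => exact h con (by simp [mem_atoms_toRule, neg])
  | fact q => exact h (fact q) (by simp [mem_atoms_toRule, head])
  | bit j b => exact h (satur j b) (by simp [mem_atoms_toRule, head])
  | lit i b => exact h (choice i) (by simp [lit_mem_atoms_toRule])

/-! ### The incidence graph and its feedback vertex sets -/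

variable [DecidableEq α]

theorem incidenceGraph_adj_inl {a : {a // a ∈ P.atoms}} {v : P.IncVertex} :
    P.incidenceGraph.Adj (Sum.inl a) v ↔ ∃ r, v = Sum.inr r ∧ a.1 ∈ r.1.atoms := by
  simp only [incidenceGraph, SimpleGraph.fromRel_adj]
  grind

theorem incidenceGraph_adj_inr {r : {r // r ∈ P}} {v : P.IncVertex} :
    P.incidenceGraph.Adj (Sum.inr r) v ↔ ∃ a, v = Sum.inl a ∧ a.1 ∈ r.1.atoms := by
  simp only [incidenceGraph, SimpleGraph.fromRel_adj]
  grind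

theorem exists_isSparseFVS (hP : ∀ r, r ∈ P ↔ ∃ x, r = toRule e A x) :
    ∃ S : Finset P.IncVertex, P.IsSparseFVS S ∧ S.card ≤ 5 + 2 * Fintype.card ι := by
  classical
  let S : Finset P.IncVertex := Finset.univ.filter fun v =>
    ∃ a, v = Sum.inl a ∧ ∀ i b, a.1 ≠ e (Atom.lit i b)
  have hS : ∀ a, Sum.inl a ∉ S → ∃ i b, a.1 = e (Atom.lit i b) := fun a ha => by
    by_contra! h
    exact ha (by simpa [S] using h)
  refine ⟨S, ⟨?_, fun a b hab ha hb r hr r' hr' h1 h2 h3 h4 => ?_⟩, ?_⟩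
  -- Ranks: negative literals 0, choice rules 1, positive literals 2, all other rules 3. A choice
  -- rule has one lower neighbour, a positive literal has only its choice rule below it, and a
  -- clause rule has a single remaining neighbour.
  · refine SimpleGraph.isAcyclic_of_rank (fun v => Sum.elim
      (fun a => if ∃ i, a.1 = e (Atom.lit i false) then 0 else 2)
      (fun r => if ∃ i, r.1 = toRule e A (choice i) then 1 else 3) v.1) ?_
    rintro ⟨v, hv⟩ ⟨w, hw⟩ ⟨w', hw'⟩ h1 h2 h3 h4
    rw [SimpleGraph.comap_adj] at h1 h2
    simp only [Function.Embedding.subtype_apply, Subtype.mk.injEq] at *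
    rcases v with a | r
    · obtain ⟨i, b, hi⟩ := hS a hv
      obtain ⟨r, rfl, hr⟩ := incidenceGraph_adj_inl.1 h1
      obtain ⟨r', rfl, hr'⟩ := incidenceGraph_adj_inl.1 h2
      have key : ∀ r : {r // r ∈ P}, a.1 ∈ r.1.atoms →
          (if ∃ i, r.1 = toRule e A (choice i) then 1 else 3) ≤
            (if ∃ i, a.1 = e (Atom.lit i false) then 0 else 2) → r.1 = toRule e A (choice i) := by
        intro r hr hle
        have h : ∃ i, r.1 = toRule e A (choice i) := by
          by_contra h
          rw [if_neg h] at hle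
          split_ifs at hle <;> omega
        obtain ⟨i', hi'⟩ := h
        rw [hi, hi', lit_mem_atoms_toRule] at hr
        simp only [choice.injEq, reduceCtorEq, false_and, exists_const, or_false] at hr
        rw [hi', hr]
      exact congrArg Sum.inr (Subtype.ext ((key r hr h3).trans (key r' hr' h4).symm))
    · obtain ⟨a, rfl, ha⟩ := incidenceGraph_adj_inr.1 h1
      obtain ⟨a', rfl, ha'⟩ := incidenceGraph_adj_inr.1 h2
      obtain ⟨i, b, hi⟩ := hS a hw
      obtain ⟨i', b', hi'⟩ := hS a' hw'
      obtain ⟨x, hx⟩ := (hP r.1).1 r.2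
      refine congrArg Sum.inl (Subtype.ext ?_)
      rw [hi, hx, lit_mem_atoms_toRule] at ha
      rw [hi', hx, lit_mem_atoms_toRule] at ha'
      rw [hi, hi']
      rcases ha with rfl | ⟨β, p, rfl, hA⟩
      · have hc : ∃ i, r.1 = toRule e A (choice i) := ⟨i, hx⟩
        simp only [Sum.elim_inl, Sum.elim_inr, if_pos hc] at h3 h4
        have h : ∀ a : {a // a ∈ P.atoms}, (if ∃ i, a.1 = e (Atom.lit i false) then 0 else 2) ≤ 1 →
            ∃ i, a.1 = e (Atom.lit i false) := fun a ha => by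
          by_contra h
          rw [if_neg h] at ha
          omega
        obtain ⟨k, hk⟩ := h _ h3
        obtain ⟨k', hk'⟩ := h _ h4
        grind [e.injective]
      · grind [e.injective]
  · obtain ⟨i, c, hi⟩ := hS a ha
    obtain ⟨i', c', hi'⟩ := hS b hb
    have hne : ¬ (i = i' ∧ c = c') := fun h => hab (Subtype.ext (by rw [hi, hi', h.1, h.2]))
    have key : ∀ r ∈ P, a.1 ∈ r.atoms → b.1 ∈ r.atoms → r = toRule e A (choice i) := by
      intro r hr h h'
      obtain ⟨x, rfl⟩ := (hP r).1 hr
      rw [hi, lit_mem_atoms_toRule] at h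
      rw [hi', lit_mem_atoms_toRule] at h'
      grind
    exact (key r hr h1 h2).trans (key r' hr' h3 h4).symm
  · let T : Finset (Atom ι κ) := insert Atom.sat (Finset.univ.image Atom.fact ∪
      Finset.univ.image fun x : ι × Bool => Atom.bit x.1 x.2)
    have hT : T.card ≤ 5 + 2 * Fintype.card ι := by
      refine (Finset.card_insert_le _ _).trans ?_
      have h1 := Finset.card_union_le (Finset.univ.image (Atom.fact (ι := ι) (κ := κ)))
        (Finset.univ.image fun x : ι × Bool => Atom.bit (κ := κ) x.1 x.2)
      have h2 := Finset.card_image_le (s := Finset.univ) (f := Atom.fact (ι := ι) (κ := κ))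
      have h3 := Finset.card_image_le (s := Finset.univ)
        (f := fun x : ι × Bool => Atom.bit (κ := κ) x.1 x.2)
      simp only [Finset.card_univ, Fintype.card_fin, Fintype.card_prod, Fintype.card_bool] at *
      omega
    -- The value at rule vertices is a dummy, since `S` consists of atoms.
    refine le_trans (Finset.card_le_card_of_injOn
      (Sum.elim (fun a => e.symm a.1) fun _ => Atom.sat) ?_ ?_) hT
    · rintro v hv
      obtain ⟨a, rfl, ha⟩ := (Finset.mem_filter.1 hv).2
      cases h : e.symm a.1 with
      | lit i b => exact absurd (e.symm_apply_eq.1 h) (ha i b)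
      | _ => simp [T, h]
    · intro v hv w hw h
      obtain ⟨a, rfl, -⟩ := (Finset.mem_filter.1 hv).2
      obtain ⟨a', rfl, -⟩ := (Finset.mem_filter.1 hw).2
      exact congrArg Sum.inl (Subtype.ext (e.symm.injective h))

theorem fvsSize_le_card {P : Program α} {S : Finset P.IncVertex} (hS : P.IsSparseFVS S) :
    P.fvsSize ≤ S.card :=
  Nat.sInf_le ⟨S, hS.1, rfl⟩

theorem sparseFvsSize_le_card {P : Program α} {S : Finset P.IncVertex} (hS : P.IsSparseFVS S) :
    P.sparseFvsSize ≤ S.card :=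
  Nat.sInf_le ⟨S, hS, rfl⟩

end Program

/-! ## Correctness of the reduction -/

namespace Val

theorem toList_injective : Function.Injective toList := fun v w h => by
  rw [← ofList_toList v, h, ofList_toList]

theorem ofNat_succ (n : ℕ) : ofNat (n + 1) = cons nil (ofNat n) := rfl

@[simp] theorem toList_ofNat (n : ℕ) : (ofNat n).toList = List.replicate n nil := toList_ofList _

theorem rapp_ofNat (a b : ℕ) : rapp (ofNat a) (ofNat b) = ofNat (a + b) := by
  induction a generalizing b with
  | zero => simp [rapp]
  | succ a ih =>
    have := ih (b + 1)
    simp only [rapp, toList_ofNat, List.replicate_succ, List.foldl_cons] at *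
    rw [← ofNat_succ, this]
    congr 1; omega

theorem ofBool_eq_ofNat (b : Bool) : ofBool b = ofNat b.toNat := by
  cases b <;> rfl

theorem eqLen_eq (a b : Val) :
    eqLen a b = ofBool (decide (a.toList.length = b.toList.length)) := by
  have h1 := dropLen_eq_nil (a := a) (b := b)
  have h2 := dropLen_eq_nil (a := b) (b := a)
  rw [eqLen]
  cases hab : dropLen a b with
  | nil =>
    cases hba : dropLen b a with
    | nil =>
      have : a.toList.length = b.toList.length := le_antisymm (h1.1 hab) (h2.1 hba)
      simp [this, ofBool]
    | cons x y =>
      have : ¬ a.toList.length = b.toList.length := fun h => by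
        simp [h2.2 h.ge] at hba
      simp [this, ofBool]
  | cons x y =>
    have : ¬ a.toList.length = b.toList.length := fun h => by
      simp [h1.2 h.le] at hab
    simp [this, ofBool]

theorem and_ofBool (a b : Bool) : and (ofBool a) (ofBool b) = ofBool (a && b) := by
  cases a <;> rfl

theorem cond_ofBool (a : Bool) (x y : Val) : cond (ofBool a) x y = bif a then y else x := by
  cases a <;> rfl

theorem eqLit_encode {n : ℕ} (l l' : Literal n) :
    eqLit l.encode l'.encode = ofBool (decide (l = l')) := by
  obtain ⟨i, b⟩ := l
  obtain ⟨i', b'⟩ := l'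
  simp only [eqLit, Literal.encode, hd_cons, tl_cons, eqLen_eq, and_ofBool, ofBool_eq_ofNat b,
    ofBool_eq_ofNat b', toList_ofNat, List.length_replicate]
  congr 1
  cases b <;> cases b' <;> simp [Fin.ext_iff]

theorem eqClause_encode {n : ℕ} (c c' : Clause3 n) :
    eqClause c.encode c'.encode = ofBool (decide (c = c')) := by
  obtain ⟨x, y, z⟩ := c
  obtain ⟨x', y', z'⟩ := c'
  simp only [eqClause, Clause3.encode, hd_cons, tl_cons, eqLit_encode, and_ofBool]
  congr 1
  simp [Prod.ext_iff]

theorem memClause_encode {n : ℕ} (c : Clause3 n) (l : List (Clause3 n)) :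
    memClause c.encode (ofList (l.map Clause3.encode)) = ofBool (decide (c ∈ l)) := by
  have : ∀ (l : List (Clause3 n)) (b : Bool), (l.map Clause3.encode).foldl
      (fun acc y => cond (eqClause c.encode y) acc (cons nil nil)) (ofBool b) =
        ofBool (b || decide (c ∈ l)) := by
    intro l
    induction l with
    | nil => simp
    | cons x l ih =>
      intro b
      rw [List.map_cons, List.foldl_cons, eqClause_encode, cond_ofBool]
      by_cases h : c = x
      · rw [decide_eq_true h, cond_true]
        refine (ih true).trans ?_
        simp [h]
      · rw [decide_eq_false h, cond_false, ih]
        simp [h]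
  rw [memClause, toList_ofList]
  have h := this l false
  rw [Bool.false_or] at h
  exact h

/-- The clauses of a list, each once. -/
theorem exists_dedup_eq {n : ℕ} (l : List (Clause3 n)) : ∃ l' : List (Clause3 n), l'.Nodup ∧
    (∀ c, c ∈ l' ↔ c ∈ l) ∧ l'.length ≤ l.length ∧
    dedup (ofList (l.map Clause3.encode)) = ofList (l'.map Clause3.encode) := by
  have : ∀ (l a : List (Clause3 n)), a.Nodup → ∃ l' : List (Clause3 n), l'.Nodup ∧
      (∀ c, c ∈ l' ↔ c ∈ l ∨ c ∈ a) ∧ l'.length ≤ l.length + a.length ∧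
      (l.map Clause3.encode).foldl (fun acc x => cond (memClause x acc) (cons x acc) acc)
        (ofList (a.map Clause3.encode)) = ofList (l'.map Clause3.encode) := by
    intro l
    induction l with
    | nil => exact fun a ha => ⟨a, ha, by simp, by simp, rfl⟩
    | cons x l ih =>
      intro a ha
      rw [List.map_cons, List.foldl_cons, memClause_encode, cond_ofBool]
      by_cases h : x ∈ a
      · rw [decide_eq_true h, cond_true]
        obtain ⟨l', h1, h2, h3, h4⟩ := ih a ha
        refine ⟨l', h1, fun c => ?_, ?_, h4⟩
        · rw [h2, List.mem_cons]
          grind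
        · rw [List.length_cons]; omega
      · rw [decide_eq_false h, cond_false]
        obtain ⟨l', h1, h2, h3, h4⟩ := ih (x :: a) (List.nodup_cons.2 ⟨h, ha⟩)
        refine ⟨l', h1, fun c => ?_, ?_, h4⟩
        · rw [h2, List.mem_cons, List.mem_cons]
          grind
        · rw [List.length_cons] at *; omega
  simpa [dedup, ofList] using this l [] List.nodup_nil

end Val

/-- All bit vectors of length `k`, in the order in which the reduction finds them. -/
def bitVectors : (k : ℕ) → List (Fin k → Bool)
  | 0 => [Fin.elim0]
  | k + 1 => (bitVectors k).reverse.flatMap fun β => [Fin.snoc β false, Fin.snoc β true]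

theorem length_bitVectors (k : ℕ) : (bitVectors k).length = 2 ^ k := by
  induction k with
  | zero => rfl
  | succ k ih => simp [bitVectors, List.length_flatMap, ih, pow_succ]

theorem mem_bitVectors {k : ℕ} (β : Fin k → Bool) : β ∈ bitVectors k := by
  induction k with
  | zero => simpa [bitVectors] using Subsingleton.elim _ _
  | succ k ih =>
    refine List.mem_flatMap.2 ⟨Fin.init β, by simpa using ih _, ?_⟩
    cases h : β (Fin.last k) <;> rw [← Fin.snoc_init_self β, h] <;> simp

theorem nodup_bitVectors (k : ℕ) : (bitVectors k).Nodup := by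
  have h : (bitVectors k).toFinset = Finset.univ :=
    Finset.eq_univ_of_forall fun β => List.mem_toFinset.2 (mem_bitVectors β)
  have := Multiset.toFinset_card_eq_card_iff_nodup (m := (bitVectors k : Multiset (Fin k → Bool)))
  rw [Multiset.coe_nodup] at this
  refine this.1 ?_
  change (bitVectors k).toFinset.card = (bitVectors k).length
  rw [h]
  simp [length_bitVectors]

/-- The list of the atoms for the bits of `β`, as a tree. -/
def encodeBits {k : ℕ} (β : Fin k → Bool) : Val :=
  Val.ofList ((List.finRange k).reverse.map fun i => Val.ofNat (5 + 2 * i + (β i).toNat))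

theorem encodeBits_snoc {k : ℕ} (β : Fin k → Bool) (b : Bool) :
    encodeBits (Fin.snoc β b : Fin (k + 1) → Bool) =
      Val.cons (Val.ofNat (5 + 2 * k + b.toNat)) (encodeBits β) := by
  simp [encodeBits, List.finRange_succ_last, Val.ofList, Function.comp_def]

namespace Val

/-- The three rules for the index bit `i`. -/
def bitRules (i : ℕ) : List Val :=
  [mkRule (pair (ofNat (5 + 2 * i)) (ofNat (5 + 2 * i + 1))) nil,
    mkRule (single (ofNat (5 + 2 * i))) (single nil),
    mkRule (single (ofNat (5 + 2 * i + 1))) (single nil)]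

/-- The state of the computation of the bit vectors when they have length `k`. -/
def bitState (k : ℕ) : Val :=
  cons (ofNat (5 + 2 * k)) (cons (ofList ((bitVectors k).map encodeBits))
    (ofList ((List.range k).reverse.flatMap bitRules ++ baseRules.toList)))

theorem double_bitVectors (k : ℕ) :
    double (ofNat (5 + 2 * k)) (ofList ((bitVectors k).map encodeBits)) =
      ofList ((bitVectors (k + 1)).map encodeBits) := by
  apply toList_injective
  rw [toList_double, toList_ofList, toList_ofList, bitVectors, List.map_flatMap, ← List.map_reverse,
    List.flatMap_map]
  simp [encodeBits_snoc, ofNat_succ]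

theorem bitStep_bitState (C : Val) (k : ℕ) : bitStep C (bitState k) =
    if C.toList.length ≤ 2 ^ k then bitState k else bitState (k + 1) := by
  have h := dropLen_eq_nil (a := C) (b := ofList ((bitVectors k).map encodeBits))
  rw [toList_ofList, List.length_map, length_bitVectors] at h
  rw [bitStep, bitState]
  simp only [hd_cons, tl_cons]
  split_ifs with hk
  · rw [h.2 hk, cond_nil]
  · cases hd : dropLen C (ofList ((bitVectors k).map encodeBits)) with
    | nil => exact absurd (h.1 hd) hk
    | cons x y =>
      rw [cond_cons, double_bitVectors, bitState]
      simp [bitRules, List.range_succ, ofList, two, ofNat_succ, mul_add]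
      rfl

/-- The state stops changing at the least `k` with `|C| ≤ 2 ^ k`, and `|C| < 2 ^ |C|` shows that
`|C|` passes reach it. -/
theorem bits_eq (C : Val) : bits C = bitState (Nat.clog 2 C.toList.length) := by
  set m := C.toList.length with hm
  have : ∀ l : List Val, l.foldl (fun acc _ => bitStep C acc) (bitState 0) =
      bitState (min l.length (Nat.clog 2 m)) := by
    intro l
    induction l using List.reverseRecOn with
    | nil => simp
    | append_singleton l x ih =>
      rw [List.foldl_append, ih, List.foldl_cons, List.foldl_nil, bitStep_bitState, ← hm]
      simp only [← Nat.clog_le_iff_le_pow one_lt_two, List.length_append, List.length_singleton]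
      split_ifs with h <;> congr 1 <;> omega
  have h := this C.toList
  rw [← hm, min_eq_right (Nat.clog_le_of_le_pow Nat.lt_two_pow_self.le)] at h
  rw [← h]
  rfl

theorem vars_eq (n c : ℕ) (R : Val) : vars (ofNat n) (cons (ofNat c) R) =
    cons (ofNat (c + 2 * n)) (ofList ((List.range n).reverse.map (fun i =>
      mkRule (pair (ofNat (c + 2 * i)) (ofNat (c + 2 * i + 1))) nil) ++ R.toList)) := by
  rw [vars, toList_ofNat]
  induction n with
  | zero => simp [ofList_toList]
  | succ n ih =>
    rw [List.replicate_succ', List.foldl_append, ih]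
    simp [varStep, two, ofNat_succ, List.range_succ, mul_add, ofList]
    rfl

theorem litAtom_encode {n : ℕ} (c : ℕ) (l : Literal n) :
    litAtom (ofNat c) l.encode = ofNat (c + 2 * l.1 + l.2.toNat) := by
  rw [litAtom, Literal.encode, hd_cons, tl_cons, ofBool_eq_ofNat, rapp_ofNat, rapp_ofNat, rapp_ofNat]
  congr 1; omega

end Val

/-- The three literals of a clause. -/
def Clause3.lits {n : ℕ} (c : Clause3 n) : Fin 3 → Option (Fin n × Bool) :=
  ![some c.1, some c.2.1, some c.2.2]

/-- The number of an atom. -/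
def Atom.num {k n : ℕ} : Atom (Fin k) (Fin n) → ℕ
  | sat => 0
  | fact q => q + 1
  | bit j b => 5 + 2 * j + b.toNat
  | lit i b => 5 + 2 * k + 2 * i + b.toNat

/-- The rules for the bit vector `β` and the literals `t`, as trees. -/
def clauseTriple {k n : ℕ} (β : Fin k → Bool) (t : Fin 3 → Option (Fin n × Bool)) : List Val :=
  [Val.mkClauseRule (encodeBits β) (Val.ofNat (Atom.ofLit (ι := Fin k) (t 0)).num) (Val.ofNat 1),
    Val.mkClauseRule (encodeBits β) (Val.ofNat (Atom.ofLit (ι := Fin k) (t 1)).num) (Val.ofNat 2),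
    Val.mkClauseRule (encodeBits β) (Val.ofNat (Atom.ofLit (ι := Fin k) (t 2)).num) (Val.ofNat 3)]

theorem Val.clauseStep_encode {k n : ℕ} (C : List (Clause3 n)) (R : Val) (β : Fin k → Bool) :
    Val.clauseStep (Val.ofNat (5 + 2 * k)) (Val.cons (Val.ofList (C.map Clause3.encode)) R)
      (encodeBits β) = Val.cons (Val.ofList (C.tail.map Clause3.encode))
        (Val.ofList (clauseTriple β ((C.map Clause3.lits).headD fun _ => none) ++ R.toList)) := by
  cases C with
  | nil => simp [Val.clauseStep, Val.ofList, clauseTriple, Atom.ofLit, Atom.num, Val.tl,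
      Val.ofList_toList]
  | cons c C =>
    simp [Val.clauseStep, Val.ofList, clauseTriple, Val.ofList_toList, Clause3.lits,
      Clause3.encode, Val.litAtom_encode, Atom.ofLit, Atom.num]

/-- The bit vectors are mapped to the clauses in turn. -/
theorem Val.exists_clauseRules_eq {k n : ℕ} (L : List (Fin k → Bool)) (hL : L.Nodup)
    (C : List (Clause3 n)) (R : Val) (hC : C.length ≤ L.length) :
    ∃ A : (Fin k → Bool) → Fin 3 → Option (Fin n × Bool),
      (Val.clauseRules (Val.ofNat (5 + 2 * k)) (Val.ofList (L.map encodeBits))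
        (Val.cons (Val.ofList (C.map Clause3.encode)) R)).tl =
          Val.ofList (L.reverse.flatMap (fun β => clauseTriple β (A β)) ++ R.toList) ∧
      (∀ c ∈ C, ∃ β ∈ L, A β = c.lits) ∧
      ∀ β ∈ L, (∃ c ∈ C, A β = c.lits) ∨ A β = fun _ => none := by
  rw [Val.clauseRules, Val.toList_ofList]
  induction L generalizing C R with
  | nil =>
    refine ⟨fun _ _ => none, by simp [Val.ofList_toList], fun c hc => ?_, by simp⟩
    rw [List.length_nil, Nat.le_zero, List.length_eq_zero_iff] at hC
    simp [hC] at hc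
  | cons β L ih =>
    rw [List.nodup_cons] at hL
    rw [List.map_cons, List.foldl_cons, Val.clauseStep_encode]
    set t := (C.map Clause3.lits).headD fun _ => none with ht
    obtain ⟨A, h1, h2, h3⟩ := ih hL.2 C.tail (Val.ofList (clauseTriple β t ++ R.toList))
      (by rw [List.length_tail]; rw [List.length_cons] at hC; omega)
    -- As vectors do not repeat, the value at `β` can be set without disturbing the assignment for
    -- the rest of the list.
    have hA : ∀ β' ∈ L, Function.update A β t β' = A β' := fun β' h =>
      Function.update_of_ne (ne_of_mem_of_not_mem h hL.1) _ _
    refine ⟨Function.update A β t, ?_, fun c hc => ?_, fun β' hβ' => ?_⟩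
    · rw [h1, Val.toList_ofList, List.reverse_cons, List.flatMap_append, List.append_assoc]
      congr 2
      · rw [List.flatMap_def, List.flatMap_def]
        congr 1
        refine List.map_congr_left fun β' h => ?_
        rw [hA β' (by simpa using h)]
      · simp
    · cases C with
      | nil => simp at hc
      | cons c' C =>
        rcases List.mem_cons.1 hc with rfl | hc
        · exact ⟨β, by simp, by simp [ht]⟩
        · obtain ⟨β', h, h'⟩ := h2 c hc
          exact ⟨β', by simp [h], (hA β' h).trans h'⟩
    · rcases List.mem_cons.1 hβ' with rfl | hβ'
      · rw [Function.update_self]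
        cases C with
        | nil => simp [ht]
        | cons c C => exact Or.inl ⟨c, by simp, by simp [ht]⟩
      · rw [hA β' hβ']
        rcases h3 β' hβ' with ⟨c, hc, h⟩ | h
        · exact Or.inl ⟨c, List.mem_of_mem_tail hc, h⟩
        · exact Or.inr h

/-! ### Numbering of the atoms -/

namespace Atom

variable {k n : ℕ}

theorem num_lt (a : Atom (Fin k) (Fin n)) : a.num < 5 + 2 * k + 2 * n := by
  cases a with
  | sat => simp [num]
  | fact q => simp only [num]; omega
  | bit j b => have := b.toNat_le; simp only [num]; omega
  | lit i b => have := b.toNat_le; simp only [num]; omega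

theorem num_injective : Function.Injective (num : Atom (Fin k) (Fin n) → ℕ) := by
  have hb : ∀ b b' : Bool, b.toNat = b'.toNat → b = b' := by decide
  intro a a' h
  cases a with
  | sat => cases a' <;> simp only [num] at h <;> first | rfl | omega
  | fact q =>
    cases a' with
    | fact q' =>
      simp only [num] at h
      rw [Fin.ext (by omega : q.val = q')]
    | _ => simp only [num] at h; omega
  | bit j b =>
    have := b.toNat_le
    cases a' with
    | bit j' b' =>
      have := b'.toNat_le
      simp only [num] at h
      rw [Fin.ext (by omega : j.val = j'), hb b b' (by omega)]
    | _ => simp only [num] at h; omega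
  | lit i b =>
    have := b.toNat_le
    cases a' with
    | lit i' b' =>
      have := b'.toNat_le
      simp only [num] at h
      rw [Fin.ext (by omega : i.val = i'), hb b b' (by omega)]
    | bit j' b' => have := b'.toNat_le; simp only [num] at h; omega
    | _ => simp only [num] at h; omega

theorem exists_num_eq {m : ℕ} (hm : m < 5 + 2 * k + 2 * n) :
    ∃ a : Atom (Fin k) (Fin n), a.num = m := by
  have hb : ∀ r, r < 2 → (decide (r = 1)).toNat = r := by decide
  by_cases h0 : m = 0
  · exact ⟨sat, h0.symm⟩
  by_cases h1 : m < 5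
  · exact ⟨fact ⟨m - 1, by omega⟩, by simp only [num]; omega⟩
  by_cases h2 : m < 5 + 2 * k
  · refine ⟨bit ⟨(m - 5) / 2, by omega⟩ (decide ((m - 5) % 2 = 1)), ?_⟩
    simp only [num, hb _ (Nat.mod_lt (m - 5) two_pos)]
    omega
  · refine ⟨lit ⟨(m - (5 + 2 * k)) / 2, by omega⟩ (decide ((m - (5 + 2 * k)) % 2 = 1)), ?_⟩
    simp only [num, hb _ (Nat.mod_lt (m - (5 + 2 * k)) two_pos)]
    omega

/-- The numbering of the atoms. -/
noncomputable def numEquiv (k n : ℕ) : Atom (Fin k) (Fin n) ≃ Fin (5 + 2 * k + 2 * n) :=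
  Equiv.ofBijective (fun a => ⟨a.num, a.num_lt⟩)
    ⟨fun _ _ h => num_injective (Fin.ext_iff.1 h), fun m =>
      let ⟨a, ha⟩ := exists_num_eq m.2
      ⟨a, Fin.ext ha⟩⟩

theorem numEquiv_val (a : Atom (Fin k) (Fin n)) : (numEquiv k n a).val = a.num := rfl

/-- A list of atoms as a tree. -/
def encodeList (l : List (Atom (Fin k) (Fin n))) : Val := Val.ofList (l.map fun a => Val.ofNat a.num)

theorem encodesAtoms_map {s : Finset (Atom (Fin k) (Fin n))} {l : List (Atom (Fin k) (Fin n))}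
    (hl : l.Nodup) (hs : ∀ a, a ∈ s ↔ a ∈ l) :
    EncodesAtoms (s.map (numEquiv k n).toEmbedding) (encodeList l) := by
  refine ⟨l.map (numEquiv k n), l.map fun a => Val.ofNat a.num, ?_, ?_, rfl⟩
  · have : s.val = (l : Multiset (Atom (Fin k) (Fin n))) :=
      (Multiset.Nodup.ext s.nodup (Multiset.coe_nodup.2 hl)).2 (by simpa using hs)
    rw [Finset.map_val, this]
    rfl
  · rw [List.forall₂_map_left_iff, List.forall₂_map_right_iff]
    exact List.forall₂_same.2 fun a _ => by rw [numEquiv_val]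

end Atom

/-! ### Encoding of the rules -/

namespace RuleIx

open Atom (encodeList numEquiv)

variable {k n : ℕ}

def headList : RuleIx (Fin k) (Fin n) → List (Atom (Fin k) (Fin n))
  | con => []
  | fact q => [Atom.fact q]
  | choice i => [Atom.lit i false, Atom.lit i true]
  | bitChoice j => [Atom.bit j false, Atom.bit j true]
  | satur j b => [Atom.bit j b]
  | clause _ _ => [Atom.sat]

def posList (A : (Fin k → Bool) → Fin 3 → Option (Fin n × Bool)) :
    RuleIx (Fin k) (Fin n) → List (Atom (Fin k) (Fin n))
  | satur _ _ => [Atom.sat]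
  | clause β p => Atom.ofLit (A β p) :: Atom.fact p.castSucc ::
      (List.finRange k).reverse.map fun j => Atom.bit j (β j)
  | _ => []

def negList : RuleIx (Fin k) (Fin n) → List (Atom (Fin k) (Fin n))
  | con => [Atom.sat]
  | _ => []

/-- The tree for a rule. -/
def encode (A : (Fin k → Bool) → Fin 3 → Option (Fin n × Bool)) (x : RuleIx (Fin k) (Fin n)) : Val :=
  Val.cons (encodeList x.headList) (Val.cons (encodeList (x.posList A)) (encodeList x.negList))

theorem encodesRule (A : (Fin k → Bool) → Fin 3 → Option (Fin n × Bool))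
    (x : RuleIx (Fin k) (Fin n)) : EncodesRule (x.toRule (numEquiv k n) A) (x.encode A) := by
  refine ⟨_, _, _, Atom.encodesAtoms_map ?_ ?_, Atom.encodesAtoms_map ?_ ?_,
    Atom.encodesAtoms_map ?_ ?_, rfl⟩
  · cases x <;> simp [headList]
  · cases x <;> simp [headList, head]
  · cases x with
    | clause β p =>
      have h1 : Function.Injective fun j : Fin k => (Atom.bit j (β j) : Atom (Fin k) (Fin n)) :=
        fun i j h => by simpa using (Atom.bit.inj h).1
      simpa [posList, Atom.ofLit_ne_fact, (Atom.ofLit_ne_bit _ _ _).symm] using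
        (List.nodup_finRange k).map h1
    | _ => simp [posList]
  · cases x <;> simp [posList, pos]
  · cases x <;> simp [negList]
  · cases x <;> simp [negList, neg]

/-- The rules in the order in which the reduction lists them. -/
def all (k n : ℕ) : List (RuleIx (Fin k) (Fin n)) :=
  (bitVectors k).reverse.flatMap (fun β => [clause β 0, clause β 1, clause β 2]) ++
    ((List.finRange n).reverse.map choice ++
      ((List.finRange k).reverse.flatMap (fun j => [bitChoice j, satur j false, satur j true]) ++
        [con, fact 0, fact 1, fact 2, fact 3]))

theorem mem_all (x : RuleIx (Fin k) (Fin n)) : x ∈ all k n := by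
  cases x with
  | con => simp [all]
  | fact q => fin_cases q <;> simp [all]
  | choice i => simp [all]
  | bitChoice j => simp [all]
  | satur j b => cases b <;> simp [all]
  | clause β p => fin_cases p <;> simp [all, mem_bitVectors]

theorem nodup_all : (all k n).Nodup := by
  rw [all, List.nodup_append', List.nodup_append', List.nodup_append', List.nodup_flatMap,
    List.nodup_flatMap]
  refine ⟨⟨fun β _ => by simp, ?_⟩, ⟨?_, ⟨⟨fun j _ => by simp, ?_⟩, by simp, ?_⟩, ?_⟩, ?_⟩
  · refine (List.nodup_reverse.2 (nodup_bitVectors k)).imp fun h x hx hy => ?_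
    grind
  · exact (List.nodup_reverse.2 (List.nodup_finRange n)).map fun _ _ h => choice.inj h
  · refine (List.nodup_reverse.2 (List.nodup_finRange k)).imp fun h x hx hy => ?_
    grind
  · intro x hx hy
    simp only [List.mem_flatMap] at hx
    grind
  · intro x hx hy
    simp only [List.mem_append, List.mem_flatMap, List.mem_map] at hx hy
    grind
  · intro x hx hy
    simp only [List.mem_append, List.mem_flatMap, List.mem_map] at hx hy
    grind

/-- Matches the abstract list of rules with the output of the folds; the reversals arise because
each fold puts new rules at the front. -/
theorem map_encode_all (A : (Fin k → Bool) → Fin 3 → Option (Fin n × Bool)) :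
    (all k n).map (encode A) = (bitVectors k).reverse.flatMap (fun β => clauseTriple β (A β)) ++
      ((List.range n).reverse.map (fun i => Val.mkRule (Val.pair (Val.ofNat (5 + 2 * k + 2 * i))
        (Val.ofNat (5 + 2 * k + 2 * i + 1))) Val.nil) ++
        ((List.range k).reverse.flatMap Val.bitRules ++ Val.baseRules.toList)) := by
  rw [all, List.map_append, List.map_append, List.map_append]
  congr 1
  · rw [List.map_flatMap]
    congr 1
    funext β
    simp [encode, clauseTriple, headList, posList, negList, encodeList, Val.mkClauseRule, Val.mkRule,
      Val.single, encodeBits, Val.ofList, Atom.num, Function.comp_def]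
    simp [Val.ofNat, Val.ofList]
  congr 1
  · rw [← List.map_coe_finRange_eq_range, ← List.map_reverse, List.map_map, List.map_map]
    rfl
  congr 1
  · rw [← List.map_coe_finRange_eq_range, ← List.map_reverse, List.map_flatMap, List.flatMap_map]
    rfl

end RuleIx

/-- The program with the rules `RuleIx.all`. -/
noncomputable def reductionProgram (k n : ℕ)
    (A : (Fin k → Bool) → Fin 3 → Option (Fin n × Bool)) : Program (Fin (5 + 2 * k + 2 * n)) :=
  ⟨(RuleIx.all k n).map (RuleIx.toRule (Atom.numEquiv k n) A),
    Multiset.coe_nodup.2 (RuleIx.nodup_all.map RuleIx.toRule_injective)⟩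

theorem mem_reductionProgram {k n : ℕ} {A : (Fin k → Bool) → Fin 3 → Option (Fin n × Bool)}
    (r : Rule (Fin (5 + 2 * k + 2 * n))) :
    r ∈ reductionProgram k n A ↔ ∃ x, r = RuleIx.toRule (Atom.numEquiv k n) A x := by
  rw [reductionProgram, Finset.mem_mk, Multiset.mem_coe, List.mem_map]
  simp [RuleIx.mem_all, eq_comm]

/-- The input of the consistency problem for `reductionProgram`. -/
noncomputable def reductionInput (k n : ℕ) (A : (Fin k → Bool) → Fin 3 → Option (Fin n × Bool)) :
    ProgramInput where
  numAtoms := 5 + 2 * k + 2 * n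
  prog := reductionProgram k n A
  atoms_eq := Program.atoms_eq_univ mem_reductionProgram

theorem reductionInput_encodes {k n : ℕ} (A : (Fin k → Bool) → Fin 3 → Option (Fin n × Bool)) :
    (reductionInput k n A).Encodes (Val.ofList ((RuleIx.all k n).map (RuleIx.encode A))) := by
  refine ⟨(RuleIx.all k n).map (RuleIx.toRule (Atom.numEquiv k n) A), _, rfl, ?_, rfl⟩
  rw [List.forall₂_map_left_iff, List.forall₂_map_right_iff]
  exact List.forall₂_same.2 fun x _ => x.encodesRule A

/-- The reduction maps a formula to an equivalent program, whose sparse feedback vertex size is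
logarithmic in the number of variables. -/
theorem exists_programInput (F : CNF3) : ∃ (x : ProgramInput) (k : ℕ),
    x.Encodes (Val.reduction F.encode) ∧ (x.prog.Consistent ↔ F.Satisfiable) ∧
    x.prog.fvsSize ≤ 5 + 2 * k ∧ x.prog.sparseFvsSize ≤ 5 + 2 * k ∧
    x.prog.atoms.card = 5 + 2 * k + 2 * F.numVars ∧
    2 ^ k ≤ 16 * F.numVars ^ 3 + 1 ∧ k ≤ F.clauses.length := by
  obtain ⟨n, cl⟩ := F
  obtain ⟨C, hnd, hmem, hlen, hC⟩ := Val.exists_dedup_eq cl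
  set k := Nat.clog 2 C.length with hk
  obtain ⟨A, h1, h2, h3⟩ := Val.exists_clauseRules_eq (bitVectors k) (nodup_bitVectors k) C
    (Val.ofList ((List.range n).reverse.map (fun i => Val.mkRule
        (Val.pair (Val.ofNat (5 + 2 * k + 2 * i)) (Val.ofNat (5 + 2 * k + 2 * i + 1))) Val.nil) ++
        ((List.range k).reverse.flatMap Val.bitRules ++ Val.baseRules.toList)))
    (by rw [length_bitVectors]; exact Nat.le_pow_clog one_lt_two _)
  have hP := mem_reductionProgram (A := A)
  obtain ⟨S, hS, hcard⟩ := Program.exists_isSparseFVS hP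
  rw [Fintype.card_fin] at hcard
  refine ⟨reductionInput k n A, k, ?_, ?_, (Program.fvsSize_le_card hS).trans hcard,
    (Program.sparseFvsSize_le_card hS).trans hcard, ?_, ?_, ?_⟩
  · convert reductionInput_encodes A
    rw [RuleIx.map_encode_all, Val.reduction, CNF3.encode, Val.tl_cons, Val.hd_cons, hC,
      Val.bits_eq, Val.toList_ofList, List.length_map, ← hk, Val.assemble, Val.bitState,
      Val.hd_cons, Val.tl_cons, Val.hd_cons, Val.tl_cons, Val.vars_eq, Val.tl_cons,
      Val.toList_ofList, h1, Val.toList_ofList]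
  · refine (Program.consistent_iff hP).trans ?_
    have hlits : ∀ (σ : Fin n → Bool) (c : Clause3 n), (∃ p, litHolds σ (c.lits p)) ↔
        Literal.IsTrue σ c.1 ∨ Literal.IsTrue σ c.2.1 ∨ Literal.IsTrue σ c.2.2 := by
      intro σ c
      simp [Fin.exists_fin_succ, Clause3.lits, litHolds, Literal.IsTrue]
    refine exists_congr fun σ => ⟨fun h c hc => ?_, fun h β => ?_⟩
    · obtain ⟨β, -, hβ⟩ := h2 c ((hmem c).2 hc)
      rw [← hlits, ← hβ]
      exact h β
    · rcases h3 β (mem_bitVectors β) with ⟨c, hc, hβ⟩ | hβ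
      · rw [hβ, hlits]
        exact h c ((hmem c).1 hc)
      · rw [hβ]
        exact ⟨0, trivial⟩
  · rw [(reductionInput k n A).atoms_eq, Finset.card_univ]
    exact Fintype.card_fin _
  -- There are `2 n` literals, hence `(2 n) ^ 3` distinct clauses. Minimality of `k` gives `2 ^ (k -
  -- 1) < |C|`, so that `2 ^ k` is at most twice this number; the summand `1` covers `k = 0`.
  · have h4 : C.length ≤ 8 * n ^ 3 := by
      have h5 := hnd.length_le_card
      rw [show Fintype.card (Clause3 n) = 8 * n ^ 3 by
        simp only [Fintype.card_prod, Fintype.card_fin, Fintype.card_bool]; ring] at h5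
      exact h5
    change 2 ^ k ≤ 16 * n ^ 3 + 1
    rcases Nat.lt_or_ge 1 C.length with h | h
    · have h5 := Nat.pow_pred_clog_lt_self one_lt_two h
      have h6 := Nat.clog_pos one_lt_two h
      rw [← hk] at h5 h6
      obtain ⟨j, hj⟩ : ∃ j, k = j + 1 := ⟨k - 1, by omega⟩
      rw [hj, Nat.pred_eq_sub_one, Nat.add_sub_cancel] at h5
      rw [hj, pow_succ]
      omega
    · rw [hk, Nat.clog_of_right_le_one h]
      omega
  -- This crude bound suffices to bound the number of atoms linearly in the numbers of variables and
  -- clauses.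
  · exact (Nat.clog_le_of_le_pow Nat.lt_two_pow_self.le).trans hlen

/-! ## Running times -/

/-- Set the variables `X₁, …, X_B` to `nil`. -/
def Cmd.clear : ℕ → Cmd
  | 0 => Cmd.assign 0 (Expr.var 0)
  | B + 1 => Cmd.seq (Cmd.clear B) (Cmd.assign (B + 1) Expr.nil)

theorem Run.clear (B : ℕ) (s : Store) : ∃ s', Run (Cmd.clear B) s (2 * (B + 1)) s' ∧ s' 0 = s 0 ∧
    (∀ x, 0 < x → x ≤ B → s' x = Val.nil) ∧ ∀ x, B < x → s' x = s x := by
  induction B with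
  | zero => exact ⟨_, Run.assign _ _ _, by simp [Expr.eval], by omega, fun x hx => by
      rw [Function.update_of_ne hx.ne']⟩
  | succ B ih =>
    obtain ⟨s', hr, h0, h1, h2⟩ := ih
    refine ⟨_, Run.seq hr (Run.assign _ _ _), ?_, fun x hx hxB => ?_, fun x hx => ?_⟩
    · rw [Function.update_of_ne (by omega), h0]
    · by_cases h : x = B + 1
      · rw [h, Function.update_self]
        rfl
      · rw [Function.update_of_ne h, h1 x hx (by omega)]
    · rw [Function.update_of_ne (by omega), h2 x (by omega)]

/-- A polynomial-time function is computed by a command that leaves no other data behind. -/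
theorem PolyTime.exists_run {f : Val → Val} (hf : PolyTime f) : ∃ (c : Cmd) (p : Polynomial ℕ),
    ∀ v, ∃ t, Run c (inputStore v) t (inputStore (f v)) ∧ t ≤ p.eval v.size := by
  obtain ⟨c, B, p, hc, -⟩ := hf
  refine ⟨Cmd.seq c (Cmd.clear B), p + Polynomial.C (2 * (B + 1)), fun v => ?_⟩
  obtain ⟨t, s, hr, ht, h0, hs⟩ := hc (inputStore v)
  obtain ⟨s', hr', h0', h1, h2⟩ := Run.clear B s
  have hv : inputStore v 0 = v := rfl
  have : s' = inputStore (f v) := by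
    funext x
    rcases Nat.eq_zero_or_pos x with rfl | hx
    · rw [h0', h0, hv]
      rfl
    · have hn : ∀ w, inputStore w x = Val.nil := fun w => if_neg hx.ne'
      rw [hn]
      rcases Nat.lt_or_ge B x with h | h
      · rw [h2 x h, hs x h, hn]
      · exact h1 x hx h
  refine ⟨_, this ▸ Run.seq hr hr', ?_⟩
  rw [hv] at ht
  simpa using ht

theorem Val.size_ofNat (n : ℕ) : (Val.ofNat n).size = 2 * n + 1 := by
  induction n with
  | zero => rfl
  | succ n ih =>
    rw [show Val.ofNat (n + 1) = Val.cons Val.nil (Val.ofNat n) from rfl, size_cons, ih, size_nil]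
    omega

theorem Literal.size_encode_le {n : ℕ} (l : Literal n) : l.encode.size ≤ 2 * n + 3 := by
  have h := l.1.2
  obtain ⟨i, b⟩ := l
  cases b <;> simp [Literal.encode, Val.size_ofNat, Val.ofBool] <;> omega

theorem CNF3.size_encode_le (F : CNF3) :
    F.encode.size ≤ 2 * F.numVars + F.clauses.length * (6 * F.numVars + 12) + 3 := by
  have h : ∀ c ∈ (Val.ofList (F.clauses.map Clause3.encode)).toList,
      c.size ≤ 6 * F.numVars + 11 := by
    intro c hc
    rw [Val.toList_ofList, List.mem_map] at hc
    obtain ⟨c, -, rfl⟩ := hc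
    have h1 := c.1.size_encode_le
    have h2 := c.2.1.size_encode_le
    have h3 := c.2.2.size_encode_le
    simp only [Clause3.encode, Val.size_cons]
    omega
  have h' := Val.size_le_of_forall_mem h
  rw [Val.toList_ofList, List.length_map, Nat.add_assoc (6 * _)] at h'
  norm_num at h'
  simp only [CNF3.encode, Val.size_cons, Val.size_ofNat]
  omega

/-- The finitely many exceptions to the asymptotic bound are absorbed into the constant. -/
theorem exists_forall_le_add_of_isLittleO {f : ℕ → ℝ} (hf : f =o[atTop] fun k : ℕ => (k : ℝ))
    {ε : ℝ} (hε : 0 < ε) : ∃ C : ℝ, ∀ k, f k ≤ ε * k + C := by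
  obtain ⟨N, hN⟩ := eventually_atTop.1 (hf.bound hε)
  refine ⟨∑ i ∈ Finset.range N, |f i|, fun k => ?_⟩
  have h0 : 0 ≤ ∑ i ∈ Finset.range N, |f i| := Finset.sum_nonneg fun _ _ => abs_nonneg _
  rcases Nat.lt_or_ge k N with h | h
  · have h1 := Finset.single_le_sum (f := fun i => |f i|) (fun _ _ => abs_nonneg _)
      (Finset.mem_range.2 h)
    have h2 : 0 ≤ ε * k := by positivity
    have h3 := le_abs_self (f k)
    linarith
  · have h1 := hN k h
    rw [Real.norm_eq_abs, Real.norm_of_nonneg (Nat.cast_nonneg k)] at h1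
    linarith [le_abs_self (f k)]

/-- If `k` is logarithmic in `n`, then `2 ^ o(k)` is sublinear in `n`. -/
theorem exists_two_rpow_le {f : ℕ → ℝ} (hf : f =o[atTop] fun k : ℕ => (k : ℝ)) {δ : ℝ}
    (hδ : 0 < δ) : ∃ C : ℝ, ∀ n k j : ℕ, 2 ^ k ≤ 16 * n ^ 3 + 1 → j ≤ 5 + 2 * k →
      (2 : ℝ) ^ f j ≤ δ * n + C := by
  -- With slope `1 / 12` and `j ≤ 5 + 2 k` the exponent is at most `k / 6 + 5 / 12 + C`, and `2 ^ (k
  -- / 6)` is of order at most `√n` because `2 ^ k` is of order at most `n ^ 3`.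
  obtain ⟨C, hC⟩ := exists_forall_le_add_of_isLittleO hf (show (0 : ℝ) < 1 / 12 by norm_num)
  set D : ℝ := 2 ^ (C + 5 / 12) with hD
  have hD0 : 0 < D := by positivity
  refine ⟨δ + D ^ 2 / δ, fun n k j hk hj => ?_⟩
  set r : ℝ := Real.sqrt (n + 1) with hr
  have hr2 : r ^ 2 = n + 1 := Real.sq_sqrt (by positivity)
  have hr0 : 0 ≤ r := Real.sqrt_nonneg _
  have h1 : (2 : ℝ) ^ ((k : ℝ) / 6) ≤ 2 * r := by
    refine le_of_pow_le_pow_left₀ (n := 6) (by norm_num) (by positivity) ?_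
    have h2 : ((2 : ℝ) ^ ((k : ℝ) / 6)) ^ 6 = 2 ^ k := by
      rw [← Real.rpow_natCast, ← Real.rpow_mul (by norm_num), ← Real.rpow_natCast]
      congr 1
      push_cast
      ring
    have h3 : (2 * r) ^ 6 = 64 * ((n : ℝ) + 1) ^ 3 := by
      rw [← hr2]; ring
    have h4 : (2 : ℝ) ^ k ≤ 16 * n ^ 3 + 1 := by exact_mod_cast hk
    have h5 : (0 : ℝ) ≤ n := Nat.cast_nonneg n
    rw [h2, h3]
    nlinarith [pow_nonneg h5 2, pow_nonneg h5 3]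
  have h2 : (2 : ℝ) ^ f j ≤ D * 2 ^ ((k : ℝ) / 6) := by
    rw [hD, ← Real.rpow_add (by norm_num)]
    refine Real.rpow_le_rpow_of_exponent_le (by norm_num) ?_
    have h3 : (j : ℝ) ≤ 5 + 2 * k := by exact_mod_cast hj
    have h4 := hC j
    linarith
  -- Completing the square trades the square root for an arbitrarily small multiple of `n` and a
  -- constant.
  have h3 : D * (2 * r) ≤ δ * r ^ 2 + D ^ 2 / δ := by
    have h4 : δ * r ^ 2 + D ^ 2 / δ - D * (2 * r) = (δ * r - D) ^ 2 / δ := by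
      field_simp
      ring
    have h5 : 0 ≤ (δ * r - D) ^ 2 / δ := by positivity
    linarith
  rw [hr2] at h3
  have h4 := mul_le_mul_of_nonneg_left h1 hD0.le
  linarith

/-- Both parameters are treated at once: all that matters about `size` is that a common upper bound
of the two feedback vertex sizes also bounds it. -/
theorem not_decidesWithin (hETH : ExponentialTimeHypothesis) {f : ℕ → ℝ}
    (hf : f =o[atTop] (fun k : ℕ => (k : ℝ))) (p : Polynomial ℕ) (M : Cmd) {size : ProgramInput → ℕ}
    (hsize : ∀ x k, x.prog.fvsSize ≤ k → x.prog.sparseFvsSize ≤ k → size x ≤ k) :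
    ¬ DecidesWithin M ProgramInput.Encodes (fun x => x.prog.Consistent)
        (fun x => (2 : ℝ) ^ ((2 : ℝ) ^ f (size x)) * ((p.eval x.prog.atoms.card : ℕ) : ℝ)) := by
  intro hM
  obtain ⟨δ, hδ, hETH⟩ := hETH
  obtain ⟨C, hC⟩ := exists_two_rpow_le hf hδ
  obtain ⟨c, q, hc⟩ := PolyTime.reduction.exists_run
  -- The first summand bounds the time of the reduction through the size of the formula, the second
  -- the time of `M`; the factor `2 ^ C` is the additive constant in the exponent.
  refine hETH (Cmd.seq c M) (q.comp (2 * .X + .X * (6 * .X + 12) + 3) +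
    .C ⌈(2 : ℝ) ^ C⌉₊ * p.comp (5 + 2 * .X)) fun F v hv => ?_
  obtain ⟨x, k, hx, hcons, h1, h2, hcard, hk, hkm⟩ := exists_programInput F
  obtain ⟨t, hr, ht⟩ := hc F.encode
  obtain ⟨t', s, hr', ht', hs⟩ := hM x _ hx
  refine ⟨t + t', s, hv ▸ Run.seq hr hr', ?_, hs.trans hcons⟩
  set N := F.numVars + F.clauses.length with hN
  have hsizeF : F.encode.size ≤ 2 * N + N * (6 * N + 12) + 3 := by
    refine F.size_encode_le.trans ?_
    gcongr <;> omega
  have ht1 : t ≤ q.eval (2 * N + N * (6 * N + 12) + 3) := ht.trans (q.eval_nat_mono hsizeF)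
  have hp : p.eval x.prog.atoms.card ≤ p.eval (5 + 2 * N) := by
    refine p.eval_nat_mono ?_
    rw [hcard]
    omega
  have hf' : (2 : ℝ) ^ ((2 : ℝ) ^ f (size x)) ≤ 2 ^ (δ * F.numVars) * ⌈(2 : ℝ) ^ C⌉₊ := by
    refine (Real.rpow_le_rpow_of_exponent_le one_le_two
      (hC F.numVars k (size x) hk (hsize x _ h1 h2))).trans ?_
    rw [Real.rpow_add two_pos]
    gcongr
    exact Nat.le_ceil _
  have hone : (1 : ℝ) ≤ 2 ^ (δ * F.numVars) :=
    Real.one_le_rpow one_le_two (by positivity)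
  have ht2 : (t' : ℝ) ≤ 2 ^ (δ * F.numVars) * ⌈(2 : ℝ) ^ C⌉₊ * (p.eval (5 + 2 * N) : ℕ) :=
    ht'.trans (mul_le_mul hf' (by exact_mod_cast hp) (by positivity) (by positivity))
  have ht3 : (t : ℝ) ≤ 2 ^ (δ * F.numVars) * (q.eval (2 * N + N * (6 * N + 12) + 3) : ℕ) :=
    (by exact_mod_cast ht1 : (t : ℝ) ≤ (q.eval (2 * N + N * (6 * N + 12) + 3) : ℕ)).trans
      (le_mul_of_one_le_left (by positivity) hone)
  simp only [Polynomial.eval_add, Polynomial.eval_mul, Polynomial.eval_comp, Polynomial.eval_C,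
    Polynomial.eval_X, Polynomial.eval_ofNat, Nat.cast_add, Nat.cast_mul] at *
  linarith

theorem mainTheorem3 (hETH : ExponentialTimeHypothesis) (f : ℕ → ℝ)
    (hf : f =o[atTop] (fun k : ℕ => (k : ℝ))) (p : Polynomial ℕ) (M : Cmd) :
    (¬ DecidesWithin M ProgramInput.Encodes (fun x => x.prog.Consistent)
        (fun x => (2 : ℝ) ^ ((2 : ℝ) ^ f x.prog.fvsSize) *
          ((p.eval x.prog.atoms.card : ℕ) : ℝ))) ∧
    (¬ DecidesWithin M ProgramInput.Encodes (fun x => x.prog.Consistent)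
        (fun x => (2 : ℝ) ^ ((2 : ℝ) ^ f x.prog.sparseFvsSize) *
          ((p.eval x.prog.atoms.card : ℕ) : ℝ))) := by
  exact ⟨not_decidesWithin hETH hf p M fun _ _ h _ => h,
    not_decidesWithin hETH hf p M fun _ _ _ h => h⟩
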